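/- Let $T=\{t_n\}$ be an infinite increasing sequence of nonzero real numbers, one-sided (in either direction) or two-sided, with $|t_n|\to\infty$ as $|n|\to\infty$. Let $\mu=\sum_n\mu_n\delta_{t_n}$ with all $\mu_n>0$ and $\int_{\mathbb R}\frac{d\mu(t)}{1+t^2}<\infty$. The space of Cauchy transforms is $$\mathcal H(T,\mu)=\Bigl\{f:\ f(z)=\sum_n\frac{a_n\mu_n^{1/2}}{z-t_n},\ a=\{a_n\}\in\ell^2\Bigr\}.$$ For a nonzero $f\in\mathcal H(T,\mu)$ with coefficients $a$, put $\mathcal Z_f=\{w\in\mathbb C\setminus T: f(w)=0\}\cup\{t_n\in T: a_n=0\}$. A multiple zero of $f$ is a point $w\in\mathbb C\setminus T$ at which $f$ vanishes to order at least $2$, or a point $t_n\in T$ such that $a_n=0$ and the analytic extension of $f$ to $t_n$ vanishes at $t_n$ (equivalently, it is a multiple zero of the entire function $Af$, where $A$ is an entire function with simple zeros exactly at the points of $T$). Let $D(z,r)$ be the open disk in $\mathbb C$ with center $z$ and radius $r>0$. Assume that $T$ is power separated: there are $C>0$ and $N\in\mathbb N$ such that $|t_{n+1}-t_n|\ge C|t_n|^{-N}$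 for all $n$. Then the following statements are equivalent: (i) There exists an unbounded set $S\subset\mathbb C$ such that the set $\mathcal Z_f\cap S$ is finite for every nonzero $f\in\mathcal H(T,\mu)$. (ii) The set $\mathcal Z_f\setminus\bigcup_n D(t_n,1)$ is finite for every nonzero $f\in\mathcal H(T,\mu)$. (iii) There exists a sequence of pairwise disjoint disks $\{D(t_n,r_n)\}$ such that for every nonzero $f\in\mathcal H(T,\mu)$ the set $\mathcal Z_f\setminus\bigcup_n D(t_n,r_n)$ is finite and, for all $n$ except possibly a finite number, the disk $D(t_n,r_n)$ contains at most one point of $\mathcal Z_f$. (iv) There is no nonzero $f\in\mathcal H(T,\mu)$ with infinitely many multiple zeros. -/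

import Mathlib

open MeasureTheory Filter

/-- A discrete positive measure `μ = ∑ₙ μₙ δ_{tₙ}` on the real line, with `μₙ > 0` and
`∫ dμ(t) / (1 + t ^ 2) < ∞`, carried by an infinite increasing sequence `T = {tₙ}` of nonzero reals
with `|tₙ| → ∞`. The index set is an infinite interval of integers, so that the sequence may be
two-sided, or one-sided in either direction. -/
structure CauchyData where
  /-- the set of indices: all integers, or all integers on one side of some integer -/
  I : Set ℤ
  ordConnected_I : I.OrdConnected
  infinite_I : I.Infinite
  /-- the points `tₙ` -/
  t : I → ℝ
  strictMono_t : StrictMono t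
  tendsto_t : Tendsto (fun n => |t n|) cofinite atTop
  t_ne_zero : ∀ n, t n ≠ 0
  /-- the masses `μₙ` -/
  mass : I → ℝ
  mass_pos : ∀ n, 0 < mass n
  integrable_inv : Integrable (fun x : ℝ => 1 / (1 + x ^ 2))
    (Measure.sum fun n => ENNReal.ofReal (mass n) • Measure.dirac (t n))

namespace CauchyData

variable (D : CauchyData)

/-- The set `T = {tₙ}`, as a subset of the complex plane. -/
def T : Set ℂ := Set.range fun n : D.I => (D.t n : ℂ)

/-- The sequence `T` is power separated: `|tₙ₊₁ - tₙ| ≥ C |tₙ| ^ (-N)` for all `n`, with some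
`C > 0` and some natural number `N`. -/
def PowerSeparated : Prop :=
  ∃ C : ℝ, 0 < C ∧ ∃ N : ℕ, ∀ n k : D.I, (k : ℤ) = (n : ℤ) + 1 →
    C * (|D.t n| ^ N)⁻¹ ≤ |D.t k - D.t n|

/-- The Cauchy transform `f(z) = ∑ₙ aₙ μₙ ^ (1/2) / (z - tₙ)` of a sequence `a ∈ ℓ²`; the series
converges absolutely for every `z`.
Because `x / 0 = 0`, its value at the point `tₙ` is the sum of the terms with index other
than `n`; if `aₙ = 0`, this is the value at `tₙ` of the analytic extension of `f`. -/
noncomputable def cauchyTransform (a : lp (fun _ : D.I => ℂ) 2) (z : ℂ) : ℂ :=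
  ∑' n : D.I, a n * (Real.sqrt (D.mass n) : ℂ) / (z - (D.t n : ℂ))

/-- The space `H(T, μ)` of Cauchy transforms. Each function is extended to `T` by the convention
above, which does not depend on anything but the function off `T`. -/
def space : Set (ℂ → ℂ) := Set.range D.cauchyTransform

/-- For `f ∈ H(T, μ)`, the coefficient `aₙ` of `f` vanishes. (The sequence `a` is determined by `f`,
through the residues of `f`.) -/
def CoeffEqZero (f : ℂ → ℂ) (n : D.I) : Prop :=
  ∃ a : lp (fun _ : D.I => ℂ) 2, D.cauchyTransform a = f ∧ a n = 0

/-- The zero set `Z_f = {w ∈ ℂ \ T : f w = 0} ∪ {tₙ ∈ T : aₙ = 0}` of `f ∈ H(T, μ)`. -/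
def zeroSet (f : ℂ → ℂ) : Set ℂ :=
  {w | w ∉ D.T ∧ f w = 0} ∪ {w | ∃ n : D.I, w = (D.t n : ℂ) ∧ D.CoeffEqZero f n}

/-- The set of multiple zeros of `f ∈ H(T, μ)`. A point `w` off `T` is a multiple zero if `f` vanishes
there to order at least two. A point `tₙ ∈ T` is a multiple zero if `aₙ = 0` and the analytic
extension of `f` vanishes at `tₙ`. Equivalently, these are the multiple zeros of the entire
function `A f`, where `A` is an entire function with simple zeros exactly at the points of `T`. -/
def multipleZeroSet (f : ℂ → ℂ) : Set ℂ :=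
  {w | w ∉ D.T ∧ 2 ≤ analyticOrderAt f w} ∪
    {w | ∃ n : D.I, w = (D.t n : ℂ) ∧ D.CoeffEqZero f n ∧ 1 ≤ analyticOrderAt f w}

/-- The open disk `D(tₙ, r)` in the complex plane. -/
def disk (n : D.I) (r : ℝ) : Set ℂ := Metric.ball (D.t n : ℂ) r

end CauchyData

/-! The engine is the moving of zeros. If `f` vanishes at `w` (and no pole of `f` sits there), then
`f(z) (1 - z/s) / (1 - z/w)` is again a Cauchy transform, its coefficients being `aₙ` times the
value of the factor at `tₙ` (`ct_mob`). The zero `w` is replaced by a zero at `s`, or by a vanishing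
coefficient if `s` is in `T`.

At `tₙ` the factor differs from 1 by `tₙ (s - w) / (s (w - tₙ))`. This tends to 0 for fixed `n` as
`w` goes to infinity with `|w| ≤ 2|s|`, and is at most of order `|tₙ| ^ (N + 1)` when `w` keeps a
distance of order `|tₙ| ^ (-N)` from the `tₙ` with `aₙ ≠ 0`. Dividing out `N + 1` zeros beforehand
gives the coefficients enough decay for dominated convergence, so moving a sufficiently distant zero
costs arbitrarily little in `ℓ²` (`exists_move`). Infinitely many moves with summable costs converge
to a nonzero limit that keeps all the zeros created (`exists_limit_of_step`).

Hence infinitely many separated zeros can be sent into any unbounded set, contradicting (i). Two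
zeros near a point `tₘ`, or a double one, reduce to this case: moving one to `tₘ` kills `aₘ`, and
the other becomes separated. Failure of (ii), (iii) or (iv) supplies such zeros, so (i) implies the
rest. For the return from (iv), infinitely many zeros on an imaginary ray are moved onto one another
to form double zeros; (ii) and (iii) exhibit unbounded sets directly. -/

namespace CauchyData

variable (D : CauchyData)

/-! ### Estimates for the kernels -/

theorem summable_mass_div : Summable fun n : D.I => D.mass n / (1 + D.t n ^ 2) := by
  have h := D.integrable_inv.2
  rw [hasFiniteIntegral_iff_enorm, lintegral_sum_measure] at h
  have h2 : ∀ n : D.I, ∫⁻ x, ‖1 / (1 + x ^ 2)‖ₑ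
      ∂(ENNReal.ofReal (D.mass n) • Measure.dirac (D.t n))
      = ENNReal.ofReal (D.mass n / (1 + D.t n ^ 2)) := by
    intro n
    rw [lintegral_smul_measure, lintegral_dirac, smul_eq_mul,
      Real.enorm_eq_ofReal (by positivity), ← ENNReal.ofReal_mul (D.mass_pos n).le]
    congr 1
    ring
  simp_rw [h2] at h
  have h3 := ENNReal.summable_toReal h.ne
  refine h3.congr fun n => ?_
  rw [ENNReal.toReal_ofReal]
  have := D.mass_pos n
  positivity

/-- Around a point `p`, the kernels `1 / (z - tₙ)` with `tₙ ≠ p` are uniformly comparable to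
`1 / (1 + |tₙ|)`. -/
theorem exists_kernel_bound (p : ℂ) : ∃ C > 0, ∃ ρ > 0, ∀ n : D.I, (D.t n : ℂ) ≠ p →
    ∀ z ∈ Metric.ball p ρ, 1 + |D.t n| ≤ C * ‖z - D.t n‖ := by
  have hfin : {n : D.I | ¬ (2 * ‖p‖ + 3 ≤ |D.t n|)}.Finite :=
    D.tendsto_t.eventually (eventually_ge_atTop (2 * ‖p‖ + 3))
  obtain ⟨d, hd, hdist⟩ : ∃ d > 0, ∀ n ∈ {n : D.I | ¬ (2 * ‖p‖ + 3 ≤ |D.t n|)},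
      (D.t n : ℂ) ≠ p → d ≤ ‖p - D.t n‖ := by
    refine Set.Finite.induction_on (motive := fun s _ => ∃ d > 0, ∀ n ∈ s,
      (D.t n : ℂ) ≠ p → d ≤ ‖p - D.t n‖) _ hfin ⟨1, one_pos, by simp⟩ ?_
    · rintro a s - - ⟨d, hd, h⟩
      by_cases hap : (D.t a : ℂ) = p
      · refine ⟨d, hd, ?_⟩
        rintro n (rfl | hn) hne
        · exact absurd hap hne
        · exact h n hn hne
      · refine ⟨min d ‖p - D.t a‖, lt_min hd (norm_pos_iff.2 (sub_ne_zero.2 (Ne.symm hap))), ?_⟩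
        rintro n (rfl | hn) hne
        · exact min_le_right _ _
        · exact (min_le_left _ _).trans (h n hn hne)
  -- The summand 2 serves the distant points, where `1 + |tₙ| ≤ 2 ‖z - tₙ‖`. The quotient serves the
  -- finitely many others, which stay at distance at least `d / 2` from `z`.
  have hC : 0 < (2 * ‖p‖ + 4) / (d / 2) + 2 := by positivity
  refine ⟨(2 * ‖p‖ + 4) / (d / 2) + 2, hC, min (d / 2) 1, by positivity, ?_⟩
  intro n hn z hz
  have hz1 : ‖z - p‖ < d / 2 := (mem_ball_iff_norm.1 hz).trans_le (min_le_left _ _)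
  have hz2 : ‖z - p‖ < 1 := (mem_ball_iff_norm.1 hz).trans_le (min_le_right _ _)
  by_cases hbig : 2 * ‖p‖ + 3 ≤ |D.t n|
  · have h1 : |D.t n| ≤ ‖z - D.t n‖ + ‖z - p‖ + ‖p‖ := by
      have : (D.t n : ℂ) = -(z - D.t n) + (z - p) + p := by ring
      calc |D.t n| = ‖(D.t n : ℂ)‖ := by simp
        _ = ‖-(z - D.t n) + (z - p) + p‖ := by rw [← this]
        _ ≤ _ := (norm_add₃_le).trans (by rw [norm_neg])
    have h2 : 0 ≤ (2 * ‖p‖ + 4) / (d / 2) * ‖z - D.t n‖ := by positivity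
    nlinarith
  · have h1 := hdist n hbig hn
    have h2 : ‖p - D.t n‖ ≤ ‖z - D.t n‖ + ‖z - p‖ := by
      have : p - (D.t n : ℂ) = (z - D.t n) - (z - p) := by ring
      rw [this]
      exact norm_sub_le _ _
    have h3 : d / 2 ≤ ‖z - D.t n‖ := by linarith
    have h4 : (2 * ‖p‖ + 4) ≤ (2 * ‖p‖ + 4) / (d / 2) * ‖z - D.t n‖ := by
      rw [div_mul_eq_mul_div, le_div_iff₀ (by positivity)]
      gcongr
    have h5 := norm_nonneg (z - (D.t n : ℂ))
    push Not at hbig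
    nlinarith

theorem exists_kernel_bound_at (p : ℂ) : ∃ C > 0, ∀ n : D.I, (D.t n : ℂ) ≠ p →
    1 + |D.t n| ≤ C * ‖p - D.t n‖ := by
  obtain ⟨C, hC, ρ, hρ, h⟩ := D.exists_kernel_bound p
  exact ⟨C, hC, fun n hn => h n hn p (Metric.mem_ball_self hρ)⟩

theorem sqrt_mass_div_sq_le (n : D.I) :
    (Real.sqrt (D.mass n) / (1 + |D.t n|)) ^ 2 ≤ D.mass n / (1 + D.t n ^ 2) := by
  have := D.mass_pos n
  rw [div_pow, Real.sq_sqrt this.le]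
  gcongr
  nlinarith [abs_nonneg (D.t n), sq_abs (D.t n)]

theorem summable_sqrt_mass_div_sq :
    Summable fun n : D.I => (Real.sqrt (D.mass n) / (1 + |D.t n|)) ^ 2 :=
  D.summable_mass_div.of_nonneg_of_le (fun _ => sq_nonneg _) D.sqrt_mass_div_sq_le

theorem norm_sqrt_mass_div_le {p z : ℂ} {C : ℝ} {n : D.I}
    (h : (D.t n : ℂ) ≠ p → 1 + |D.t n| ≤ C * ‖z - D.t n‖) (hp : (D.t n : ℂ) ≠ p) :
    ‖(Real.sqrt (D.mass n) : ℂ) / (z - D.t n)‖ ≤ C * (Real.sqrt (D.mass n) / (1 + |D.t n|)) := by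
  have h1 := h hp
  have h0 : 0 < 1 + |D.t n| := by positivity
  have h2 : 0 < ‖z - D.t n‖ := by
    by_contra h3
    have : ‖z - D.t n‖ = 0 := le_antisymm (not_lt.1 h3) (norm_nonneg _)
    rw [this] at h1
    linarith
  rw [norm_div, Complex.norm_real, Real.norm_of_nonneg (Real.sqrt_nonneg _),
    div_le_iff₀ h2]
  have h3 : Real.sqrt (D.mass n) = Real.sqrt (D.mass n) / (1 + |D.t n|) * (1 + |D.t n|) := by
    field_simp
  calc Real.sqrt (D.mass n) = Real.sqrt (D.mass n) / (1 + |D.t n|) * (1 + |D.t n|) := h3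
    _ ≤ Real.sqrt (D.mass n) / (1 + |D.t n|) * (C * ‖z - D.t n‖) := by gcongr
    _ = _ := by ring

theorem summable_kernel_sq (z : ℂ) :
    Summable fun n : D.I => ‖(Real.sqrt (D.mass n) : ℂ) / (z - D.t n)‖ ^ 2 := by
  obtain ⟨C, hC, h⟩ := D.exists_kernel_bound_at z
  refine (D.summable_sqrt_mass_div_sq.mul_left (C ^ 2)).of_nonneg_of_le
    (fun _ => sq_nonneg _) fun n => ?_
  by_cases hn : (D.t n : ℂ) = z
  · rw [hn, sub_self, div_zero, norm_zero, zero_pow two_ne_zero]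
    positivity
  · rw [← mul_pow]
    gcongr
    exact D.norm_sqrt_mass_div_le (h n) hn

/-! ### Weighted sequences and closed conditions on coefficients -/

/-- The Cauchy transform of an arbitrary sequence. -/
noncomputable def ct (x : D.I → ℂ) (z : ℂ) : ℂ :=
  ∑' n : D.I, x n * (Real.sqrt (D.mass n) : ℂ) / (z - (D.t n : ℂ))

/-- Square summability with the weight `(1 + |tₙ|) ^ k`. -/
def Sq (k : ℕ) (x : D.I → ℂ) : Prop :=
  Summable fun n : D.I => ((1 + |D.t n|) ^ k * ‖x n‖) ^ 2

variable {D}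

theorem Sq.of_le {k j : ℕ} {x y : D.I → ℂ} (hx : D.Sq k x) (C : ℝ)
    (h : ∀ n, (1 + |D.t n|) ^ j * ‖y n‖ ≤ C * ((1 + |D.t n|) ^ k * ‖x n‖)) : D.Sq j y := by
  refine (hx.mul_left (C ^ 2)).of_nonneg_of_le (fun _ => sq_nonneg _) fun n => ?_
  rw [← mul_pow]
  have := h n
  gcongr

theorem Sq.zero {k : ℕ} {x : D.I → ℂ} (hx : D.Sq k x) : D.Sq 0 x := by
  refine hx.of_le 1 fun n => ?_
  rw [one_mul, pow_zero]
  gcongr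
  exact one_le_pow₀ (by linarith [abs_nonneg (D.t n)])

theorem sq_zero_iff_memℓp {x : D.I → ℂ} : D.Sq 0 x ↔ Memℓp x 2 := by
  rw [memℓp_gen_iff (by norm_num)]
  simp [Sq]

theorem sq_zero_coe (a : lp (fun _ : D.I => ℂ) 2) : D.Sq 0 a := sq_zero_iff_memℓp.2 a.2

theorem summable_mul_of_sq {x v : D.I → ℂ} (hx : D.Sq 0 x) (hv : Summable fun n => ‖v n‖ ^ 2) :
    Summable fun n => x n * v n := by
  refine Summable.of_norm_bounded (hx.add hv) fun n => ?_
  rw [norm_mul, pow_zero, one_mul]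
  nlinarith [sq_nonneg (‖x n‖ - ‖v n‖), sq_nonneg (‖x n‖), sq_nonneg (‖v n‖)]

theorem summable_ct {x : D.I → ℂ} (hx : D.Sq 0 x) (z : ℂ) :
    Summable fun n : D.I => x n * (Real.sqrt (D.mass n) : ℂ) / (z - (D.t n : ℂ)) :=
  (summable_mul_of_sq hx (D.summable_kernel_sq z)).congr fun _ => (mul_div_assoc _ _ _).symm

/-- The sum is the inner product with the conjugate of `v`, hence continuous in `a`. This is why
prescribed zeros survive `ℓ²` limits. -/
theorem isClosed_tsum_mul_eq_zero {v : D.I → ℂ} (hv : Summable fun n => ‖v n‖ ^ 2) :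
    IsClosed {a : lp (fun _ : D.I => ℂ) 2 | ∑' n, a n * v n = 0} := by
  have hv' : Memℓp (fun n => star (v n)) 2 := by
    rw [memℓp_gen_iff (by norm_num)]
    simpa using hv
  let V : lp (fun _ : D.I => ℂ) 2 := ⟨_, hv'⟩
  have : ∀ a : lp (fun _ : D.I => ℂ) 2, inner ℂ V a = ∑' n, a n * v n := by
    intro a
    rw [lp.inner_eq_tsum]
    refine tsum_congr fun n => ?_
    simp [V]
  simp_rw [← this]
  exact isClosed_eq (continuous_const.inner continuous_id) continuous_const

theorem isClosed_ct_eq_zero (z : ℂ) : IsClosed {a : lp (fun _ : D.I => ℂ) 2 | D.ct a z = 0} := by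
  convert isClosed_tsum_mul_eq_zero (D.summable_kernel_sq z) using 5
  simp only [ct, mul_div_assoc]

theorem isClosed_coeff_eq_zero (n : D.I) : IsClosed {a : lp (fun _ : D.I => ℂ) 2 | a n = 0} :=
  isClosed_eq ((continuous_apply n).comp (lp.uniformContinuous_coe.continuous)) continuous_const

/-! ### Analyticity, residues, isolated zeros -/

/-- Any term singular at `p` has coefficient zero, and the others are dominated near `p` by a
summable sequence, so the sum is holomorphic there. -/
theorem analyticAt_ct {x : D.I → ℂ} (hx : D.Sq 0 x) {p : ℂ}
    (hp : ∀ n, (D.t n : ℂ) = p → x n = 0) : AnalyticAt ℂ (D.ct x) p := by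
  obtain ⟨C, hC, ρ, hρ, h⟩ := D.exists_kernel_bound p
  have hsum : Summable fun n : D.I => ‖x n‖ * (C * (Real.sqrt (D.mass n) / (1 + |D.t n|))) := by
    have h1 := (D.summable_sqrt_mass_div_sq.mul_left (C ^ 2)).add hx
    refine h1.of_nonneg_of_le (fun n => by positivity) fun n => ?_
    rw [pow_zero, one_mul, ← mul_pow]
    set c := C * (Real.sqrt (D.mass n) / (1 + |D.t n|))
    nlinarith [sq_nonneg (‖x n‖ - c), sq_nonneg (‖x n‖), sq_nonneg c]
  have hdiff : DifferentiableOn ℂ (D.ct x) (Metric.ball p ρ) := by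
    refine Complex.differentiableOn_tsum_of_summable_norm hsum (fun n => ?_) Metric.isOpen_ball
      fun n z hz => ?_
    · by_cases hn : (D.t n : ℂ) = p
      · simp [hp n hn]
      · intro z hz
        have h0 : z - (D.t n : ℂ) ≠ 0 := by
          intro h0
          have := h n hn z hz
          rw [h0, norm_zero, mul_zero] at this
          linarith [abs_nonneg (D.t n)]
        fun_prop (disch := assumption)
    · by_cases hn : (D.t n : ℂ) = p
      · simp [hp n hn]
      · rw [mul_div_assoc, norm_mul]
        gcongr
        exact D.norm_sqrt_mass_div_le (fun hn => h n hn z hz) hn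
  exact hdiff.analyticAt (Metric.ball_mem_nhds p hρ)

theorem ct_sub {x y : D.I → ℂ} (hx : D.Sq 0 x) (hy : D.Sq 0 y) (z : ℂ) :
    D.ct (fun n => x n - y n) z = D.ct x z - D.ct y z := by
  rw [ct, ct, ct, ← (summable_ct hx z).tsum_sub (summable_ct hy z)]
  refine tsum_congr fun n => ?_
  ring

-- Isolates the polar part at `tₘ`; the remaining transform is analytic there. At `z = tₘ` itself
-- the identity rests on `x / 0 = 0`.
open Classical in
theorem ct_eq_add_update {x : D.I → ℂ} (hx : D.Sq 0 x) (m : D.I) (z : ℂ) :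
    D.ct x z = x m * (Real.sqrt (D.mass m) : ℂ) / (z - (D.t m : ℂ)) +
      D.ct (Function.update x m 0) z := by
  rw [ct, (summable_ct hx z).tsum_eq_add_tsum_ite m, ct]
  congr 1
  refine tsum_congr fun n => ?_
  by_cases h : n = m
  · subst h; simp
  · simp [h]

open Classical in
theorem Sq.update {k : ℕ} {x : D.I → ℂ} (hx : D.Sq k x) (m : D.I) :
    D.Sq k (Function.update x m 0) := by
  refine hx.of_le 1 fun n => ?_
  by_cases h : n = m
  · subst h
    simp only [Function.update_self, norm_zero, mul_zero]
    positivity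
  · simp [h]

theorem t_eq_iff {n m : D.I} : (D.t n : ℂ) = D.t m ↔ n = m := by
  rw [Complex.ofReal_inj]
  exact D.strictMono_t.injective.eq_iff

theorem meromorphicAt_ct {x : D.I → ℂ} (hx : D.Sq 0 x) (p : ℂ) : MeromorphicAt (D.ct x) p := by
  classical
  by_cases hp : ∃ m, (D.t m : ℂ) = p
  · obtain ⟨m, rfl⟩ := hp
    have h1 : D.ct x = (fun z => x m * (Real.sqrt (D.mass m) : ℂ) / (z - (D.t m : ℂ))) +
        D.ct (Function.update x m 0) := funext (ct_eq_add_update hx m)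
    rw [h1]
    refine MeromorphicAt.add (by fun_prop) (AnalyticAt.meromorphicAt (analyticAt_ct (hx.update m) ?_))
    intro n hn
    rw [t_eq_iff.1 hn]
    simp
  · push Not at hp
    exact (analyticAt_ct hx fun n hn => absurd hn (hp n)).meromorphicAt

theorem tendsto_mul_ct {x : D.I → ℂ} (hx : D.Sq 0 x) (m : D.I) :
    Tendsto (fun z => (z - D.t m) * D.ct x z) (nhdsWithin (D.t m : ℂ) {(D.t m : ℂ)}ᶜ)
      (nhds (x m * Real.sqrt (D.mass m))) := by
  classical
  have hA : AnalyticAt ℂ (D.ct (Function.update x m 0)) (D.t m : ℂ) := by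
    refine analyticAt_ct (hx.update m) fun n hn => ?_
    rw [t_eq_iff.1 hn]
    simp
  have h1 : Tendsto (fun z : ℂ => x m * (Real.sqrt (D.mass m) : ℂ) +
      (z - D.t m) * D.ct (Function.update x m 0) z) (nhdsWithin (D.t m : ℂ) {(D.t m : ℂ)}ᶜ)
      (nhds (x m * Real.sqrt (D.mass m) + ((D.t m : ℂ) - D.t m) *
        D.ct (Function.update x m 0) (D.t m))) := by
    refine Tendsto.mono_left ?_ nhdsWithin_le_nhds
    have : ContinuousAt (fun z : ℂ => x m * (Real.sqrt (D.mass m) : ℂ) +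
      (z - D.t m) * D.ct (Function.update x m 0) z) (D.t m : ℂ) := by
      have := hA.continuousAt
      fun_prop
    exact this
  rw [sub_self, zero_mul, add_zero] at h1
  refine h1.congr' ?_
  filter_upwards [self_mem_nhdsWithin] with z hz
  have hz' : z - (D.t m : ℂ) ≠ 0 := sub_ne_zero.2 hz
  rw [ct_eq_add_update hx m z]
  field_simp

theorem coeff_eq_zero_of_frequently {x : D.I → ℂ} (hx : D.Sq 0 x) (m : D.I)
    (h : ∃ᶠ z in nhdsWithin (D.t m : ℂ) {(D.t m : ℂ)}ᶜ, D.ct x z = 0) : x m = 0 := by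
  by_contra hm
  have hne : x m * (Real.sqrt (D.mass m) : ℂ) ≠ 0 :=
    mul_ne_zero hm (by exact_mod_cast (Real.sqrt_pos.2 (D.mass_pos m)).ne')
  have := (tendsto_mul_ct hx m).eventually_ne hne
  exact h (this.mono fun z hz h0 => hz (by rw [h0, mul_zero]))

theorem eq_zero_of_ct_eq_zero {x : D.I → ℂ} (hx : D.Sq 0 x) (h : D.ct x = 0) : x = 0 := by
  funext m
  exact coeff_eq_zero_of_frequently hx m (Eventually.frequently (Eventually.of_forall
    fun z => congrFun h z))

theorem eq_of_ct_eq {x y : D.I → ℂ} (hx : D.Sq 0 x) (hy : D.Sq 0 y) (h : D.ct x = D.ct y) :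
    x = y := by
  have h1 : (fun n => x n - y n) = 0 := by
    refine eq_zero_of_ct_eq_zero ?_ (funext fun z => ?_)
    · exact sq_zero_iff_memℓp.2 ((sq_zero_iff_memℓp.1 hx).sub (sq_zero_iff_memℓp.1 hy))
    · rw [ct_sub hx hy, h]; simp
  funext n
  exact sub_eq_zero.1 (congrFun h1 n)

/-- A nonzero coefficient is a nonzero residue, so the meromorphic order is finite at one point, and
therefore everywhere on the connected plane. -/
theorem eventually_ct_ne_zero {x : D.I → ℂ} (hx : D.Sq 0 x) (h0 : x ≠ 0) (p : ℂ) :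
    ∀ᶠ z in nhdsWithin p {p}ᶜ, D.ct x z ≠ 0 := by
  obtain ⟨m, hm⟩ := Function.ne_iff.1 h0
  have hmer : MeromorphicOn (D.ct x) Set.univ := fun p _ => meromorphicAt_ct hx p
  have h1 : meromorphicOrderAt (D.ct x) (D.t m) ≠ ⊤ := by
    intro htop
    exact hm (coeff_eq_zero_of_frequently hx m (meromorphicOrderAt_eq_top_iff.1 htop).frequently)
  have h2 := (hmer.exists_meromorphicOrderAt_ne_top_iff_forall isConnected_univ).1
    ⟨⟨_, trivial⟩, h1⟩ ⟨p, trivial⟩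
  exact (meromorphicOrderAt_ne_top_iff_eventually_ne_zero (meromorphicAt_ct hx p)).1 h2

theorem finite_ct_zeros {x : D.I → ℂ} (hx : D.Sq 0 x) (h0 : x ≠ 0) (R : ℝ) :
    {z | D.ct x z = 0 ∧ ‖z‖ ≤ R}.Finite := by
  by_contra hinf
  obtain ⟨p, -, hp⟩ := Set.Infinite.exists_accPt_of_subset_isCompact hinf
    (isCompact_closedBall (0 : ℂ) R) fun z hz => by simpa using hz.2
  rw [accPt_iff_frequently_nhdsNE] at hp
  exact hp ((eventually_ct_ne_zero hx h0 p).mono fun z hz hz' => hz hz'.1)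

theorem finite_t_le (R : ℝ) : {n : D.I | |D.t n| ≤ R}.Finite := by
  have := D.tendsto_t.eventually (eventually_gt_atTop R)
  simpa [Filter.Eventually, mem_cofinite, Set.compl_ofPred] using this

/-! ### Multiplication by Möbius functions -/

/-- The coefficients of `f` vanish at the indices `n` with `tₙ = w`. -/
def Van (x : D.I → ℂ) (w : ℂ) : Prop := ∀ n, (D.t n : ℂ) = w → x n = 0

/-- The coefficients multiplied by the values of `κ + l / (w - z)` at the points `tₙ`. -/
noncomputable def mulMob (κ l w : ℂ) (x : D.I → ℂ) : D.I → ℂ :=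
  fun n => x n * (κ + l / (w - D.t n))

theorem Van.mob {x : D.I → ℂ} {z : ℂ} (h : Van x z) (κ l w : ℂ) : Van (mulMob κ l w x) z :=
  fun n hn => by rw [mulMob, h n hn, zero_mul]

theorem mob_comm (κ l w κ' l' w' : ℂ) (x : D.I → ℂ) :
    mulMob κ l w (mulMob κ' l' w' x) = mulMob κ' l' w' (mulMob κ l w x) := by
  funext n
  simp only [mulMob]
  ring

/-- If the Cauchy transform of `x` vanishes at `w`, then its product with `κ + l / (w - z)` is
again a Cauchy transform. -/
theorem ct_mob {x : D.I → ℂ} (hx : D.Sq 0 x) {w z : ℂ} (κ l : ℂ) (hw : D.ct x w = 0)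
    (hxw : Van x w) (hxz : Van x z) (hne : z ≠ w) :
    D.ct (mulMob κ l w x) z = (κ + l / (w - z)) * D.ct x z := by
  -- Resolvent identity: `l / ((w - t)(z - t)) = l / (w - z) * (1 / (z - t) - 1 / (w - t))`. The
  -- second part sums to a multiple of the value at `w`, which is zero.
  have h1 := ((summable_ct hx z).mul_left (κ + l / (w - z))).tsum_sub
    ((summable_ct hx w).mul_left (l / (w - z)))
  rw [tsum_mul_left, tsum_mul_left] at h1
  change _ = _ * D.ct x z - _ * D.ct x w at h1
  rw [hw, mul_zero, sub_zero] at h1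
  rw [← h1, ct]
  refine tsum_congr fun n => ?_
  by_cases hn : x n = 0
  · simp [mulMob, hn]
  · have h2 : w - D.t n ≠ 0 := fun h => hn (hxw n (sub_eq_zero.1 h).symm)
    have h3 : z - D.t n ≠ 0 := fun h => hn (hxz n (sub_eq_zero.1 h).symm)
    have h4 : w - z ≠ 0 := sub_ne_zero.2 hne.symm
    simp only [mulMob]
    field_simp
    ring

theorem Sq.mob {k : ℕ} {x : D.I → ℂ} (hx : D.Sq k x) (κ l : ℂ) {w : ℂ} (hw : Van x w) :
    D.Sq k (mulMob κ l w x) := by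
  obtain ⟨C, hC, h⟩ := D.exists_kernel_bound_at w
  refine hx.of_le (‖κ‖ + ‖l‖ * C) fun n => ?_
  by_cases hn : (D.t n : ℂ) = w
  · simp [mulMob, hw n hn]
  · have h1 := h n hn
    have h2 : 0 < ‖w - D.t n‖ := norm_pos_iff.2 (sub_ne_zero.2 (Ne.symm hn))
    have h3 : ‖κ + l / (w - D.t n)‖ ≤ ‖κ‖ + ‖l‖ * C := by
      refine (norm_add_le _ _).trans ?_
      rw [norm_div, div_eq_mul_inv]
      gcongr
      rw [inv_le_iff_one_le_mul₀ h2]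
      linarith [abs_nonneg (D.t n)]
    rw [mulMob, norm_mul]
    calc (1 + |D.t n|) ^ k * (‖x n‖ * ‖κ + l / (w - D.t n)‖)
        ≤ (1 + |D.t n|) ^ k * (‖x n‖ * (‖κ‖ + ‖l‖ * C)) := by gcongr
      _ = _ := by ring

/-- With `κ = 0` the factor decays like `1 / (1 + |tₙ|)`, which buys one more power of the weight.
-/
theorem Sq.mob_succ {k : ℕ} {x : D.I → ℂ} (hx : D.Sq k x) (l : ℂ) {w : ℂ} (hw : Van x w) :
    D.Sq (k + 1) (mulMob 0 l w x) := by
  obtain ⟨C, hC, h⟩ := D.exists_kernel_bound_at w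
  refine hx.of_le (‖l‖ * C) fun n => ?_
  by_cases hn : (D.t n : ℂ) = w
  · simp [mulMob, hw n hn]
  · have h1 := h n hn
    have h2 : 0 < ‖w - D.t n‖ := norm_pos_iff.2 (sub_ne_zero.2 (Ne.symm hn))
    rw [mulMob, norm_mul, zero_add, norm_div]
    calc (1 + |D.t n|) ^ (k + 1) * (‖x n‖ * (‖l‖ / ‖w - D.t n‖))
        = (1 + |D.t n|) ^ k * ‖x n‖ * ‖l‖ * ((1 + |D.t n|) / ‖w - D.t n‖) := by ring
      _ ≤ (1 + |D.t n|) ^ k * ‖x n‖ * ‖l‖ * C := by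
          gcongr
          rwa [div_le_iff₀ h2]
      _ = _ := by ring

/-! ### The cost of moving a zero -/

/-- Multiplication by `(1 - z / s) / (1 - z / w)`: a zero at `w` is moved to `s`. -/
noncomputable def move (w s : ℂ) (x : D.I → ℂ) : D.I → ℂ := mulMob (w / s) (w / s * (s - w)) w x

theorem move_factor_sub_one {w s t : ℂ} (hs : s ≠ 0) (ht : w - t ≠ 0) :
    w / s + w / s * (s - w) / (w - t) - 1 = t * (s - w) / (s * (w - t)) := by
  field_simp
  ring

theorem move_factor_self {w s : ℂ} (h : s ≠ w) :
    w / s + w / s * (s - w) / (w - s) = 0 := by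
  have : w - s ≠ 0 := sub_ne_zero.2 h.symm
  field_simp
  ring

theorem norm_move_factor_sub_one_le {w s t : ℂ} (hs : 0 < ‖s‖) (ht : w - t ≠ 0)
    (hws : ‖w‖ ≤ 2 * ‖s‖) :
    ‖w / s + w / s * (s - w) / (w - t) - 1‖ ≤ 3 * ‖t‖ / ‖w - t‖ := by
  rw [move_factor_sub_one (norm_pos_iff.1 hs) ht, norm_div, norm_mul, norm_mul,
    div_le_div_iff₀ (mul_pos hs (norm_pos_iff.2 ht)) (norm_pos_iff.2 ht)]
  have : ‖s - w‖ ≤ 3 * ‖s‖ := (norm_sub_le _ _).trans (by linarith)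
  calc ‖t‖ * ‖s - w‖ * ‖w - t‖ ≤ ‖t‖ * (3 * ‖s‖) * ‖w - t‖ := by gcongr
    _ = _ := by ring

/-- The dominating bound: `N` powers come from the distance of `w` to `tₙ`, one more from the
numerator `tₙ`. No distance is required at `tₙ = s`, which is what lets a zero be moved to the very
point of `T` it is close to. -/
theorem norm_move_sub_le {x : D.I → ℂ} {N : ℕ} {δ : ℝ} (hδ : 0 < δ) {w s : ℂ} (hs : 0 < ‖s‖)
    (hws : ‖w‖ ≤ 2 * ‖s‖) (hw : Van x w) (n : D.I)
    (hn : x n ≠ 0 → (D.t n : ℂ) ≠ s → δ / (1 + |D.t n|) ^ N ≤ ‖w - D.t n‖) :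
    ‖move w s x n - x n‖ ≤ (3 / δ + 1) * ((1 + |D.t n|) ^ (N + 1) * ‖x n‖) := by
  have h1 : move w s x n - x n =
      x n * (w / s + w / s * (s - w) / (w - D.t n) - 1) := by
    simp only [move, mulMob]
    ring
  have hT : 1 ≤ (1 + |D.t n|) ^ (N + 1) := one_le_pow₀ (by linarith [abs_nonneg (D.t n)])
  by_cases hxn : x n = 0
  · simp [move, mulMob, hxn]
  have hwn : w - D.t n ≠ 0 := fun h => hxn (hw n (sub_eq_zero.1 h).symm)
  rw [h1, norm_mul]
  suffices h : ‖w / s + w / s * (s - w) / (w - D.t n) - 1‖ ≤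
      (3 / δ + 1) * (1 + |D.t n|) ^ (N + 1) by
    calc _ ≤ ‖x n‖ * ((3 / δ + 1) * (1 + |D.t n|) ^ (N + 1)) := by gcongr
      _ = _ := by ring
  have h3 : 0 < 3 / δ := by positivity
  -- At `tₙ = s` the factor is 0, so the change is exactly `‖x n‖`, however close `w` is.
  by_cases hts : (D.t n : ℂ) = s
  · rw [hts] at hwn ⊢
    rw [move_factor_self (sub_ne_zero.1 hwn).symm, zero_sub, norm_neg, norm_one]
    nlinarith
  · refine (norm_move_factor_sub_one_le hs hwn hws).trans ?_
    have h4 := hn hxn hts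
    rw [div_le_iff₀ (by positivity)] at h4
    rw [div_le_iff₀ (norm_pos_iff.2 hwn), Complex.norm_real, Real.norm_eq_abs]
    have h5 : 3 ≤ 3 / δ * (‖w - D.t n‖ * (1 + |D.t n|) ^ N) := by
      calc (3 : ℝ) = 3 / δ * δ := by field_simp
        _ ≤ _ := by gcongr
    calc 3 * |D.t n| ≤ 3 / δ * (‖w - D.t n‖ * (1 + |D.t n|) ^ N) * (1 + |D.t n|) := by
          gcongr
          linarith
      _ = 3 / δ * (1 + |D.t n|) ^ (N + 1) * ‖w - D.t n‖ := by ring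
      _ ≤ _ := by gcongr; linarith

theorem norm_move_sub_le_of_large (x : D.I → ℂ) {w s : ℂ} (hws : ‖w‖ ≤ 2 * ‖s‖) (n : D.I)
    (hn : 2 * |D.t n| < ‖w‖) : ‖move w s x n - x n‖ ≤ ‖x n‖ * (6 * |D.t n| / ‖w‖) := by
  have h0 := abs_nonneg (D.t n)
  have h1 : move w s x n - x n =
      x n * (w / s + w / s * (s - w) / (w - D.t n) - 1) := by
    simp only [move, mulMob]
    ring
  have h2 : ‖w‖ / 2 ≤ ‖w - D.t n‖ := by
    have := norm_sub_norm_le w (D.t n : ℂ)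
    rw [Complex.norm_real, Real.norm_eq_abs] at this
    linarith
  have h3 : 0 < ‖w - D.t n‖ := by linarith
  rw [h1, norm_mul]
  gcongr
  refine (norm_move_factor_sub_one_le (by linarith) (norm_pos_iff.1 h3) hws).trans ?_
  rw [Complex.norm_real, Real.norm_eq_abs, div_le_div_iff₀ h3 (by linarith)]
  nlinarith

/-- Moving a zero `w` far away changes the coefficients little. -/
theorem exists_radius_move {x : D.I → ℂ} {N : ℕ} {δ : ℝ} (hδ : 0 < δ) (hx : D.Sq (N + 1) x)
    {ε : ℝ} (hε : 0 < ε) : ∃ R, ∀ w s : ℂ, R ≤ ‖w‖ → ‖w‖ ≤ 2 * ‖s‖ → Van x w →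
      (∀ n, x n ≠ 0 → (D.t n : ℂ) ≠ s → δ / (1 + |D.t n|) ^ N ≤ ‖w - D.t n‖) →
      ∑' n, ‖move w s x n - x n‖ ^ 2 < ε := by
  -- A failure for every radius gives moves with `‖w j‖ → ∞` and cost at least `ε`, against
  -- dominated convergence.
  by_contra! hcon
  choose w s hw hws hv hn hlt using fun j : ℕ => hcon (j + 1)
  have hw0 : ∀ j, 0 < ‖w j‖ := fun j => lt_of_lt_of_le (by positivity) (hw j)
  have hwt : Tendsto (fun j => ‖w j‖) atTop atTop :=
    tendsto_atTop_mono (fun j => le_trans (by linarith) (hw j)) tendsto_natCast_atTop_atTop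
  have h1 := tendsto_tsum_of_dominated_convergence (𝓕 := atTop)
    (f := fun j n => ‖move (w j) (s j) x n - x n‖ ^ 2) (g := fun _ => (0 : ℝ))
    (hx.mul_left ((3 / δ + 1) ^ 2)) (fun n => ?_) (Eventually.of_forall fun j n => ?_)
  · rw [tsum_zero] at h1
    exact absurd (ge_of_tendsto' h1 hlt) (not_le.2 hε)
  · have h2 : Tendsto (fun j => ‖x n‖ * (6 * |D.t n| / ‖w j‖)) atTop (nhds 0) := by
      simpa using (hwt.const_div_atTop (6 * |D.t n|)).const_mul ‖x n‖
    have h3 : Tendsto (fun j => ‖move (w j) (s j) x n - x n‖) atTop (nhds 0) := by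
      refine tendsto_of_tendsto_of_tendsto_of_le_of_le' tendsto_const_nhds h2
        (Eventually.of_forall fun _ => norm_nonneg _) ?_
      filter_upwards [hwt.eventually_gt_atTop (2 * |D.t n|)] with j hj
      exact norm_move_sub_le_of_large x (hws j) n hj
    simpa using h3.pow 2
  · rw [Real.norm_of_nonneg (sq_nonneg _), ← mul_pow]
    gcongr
    exact norm_move_sub_le hδ (by linarith [hw0 j, hws j]) (hws j) (hv j) n (hn j n)

theorem exists_move {a : lp (fun _ : D.I => ℂ) 2} {N : ℕ} {δ : ℝ} (hδ : 0 < δ)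
    (ha : D.Sq (N + 1) a) {ε : ℝ} (hε : 0 < ε) :
    ∃ R, ∀ w s : ℂ, R ≤ ‖w‖ → ‖w‖ ≤ 2 * ‖s‖ → Van a w →
      (∀ n, a n ≠ 0 → (D.t n : ℂ) ≠ s → δ / (1 + |D.t n|) ^ N ≤ ‖w - D.t n‖) →
      ∃ b : lp (fun _ : D.I => ℂ) 2, (b : D.I → ℂ) = move w s a ∧ ‖b - a‖ < ε := by
  obtain ⟨R, hR⟩ := exists_radius_move hδ ha (pow_pos hε 2)
  refine ⟨R, fun w s h1 h2 h3 h4 => ?_⟩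
  refine ⟨⟨move w s a, sq_zero_iff_memℓp.1 ((ha.mob _ _ h3).zero)⟩, rfl, ?_⟩
  have h5 := hR w s h1 h2 h3 h4
  refine lt_of_pow_lt_pow_left₀ 2 hε.le (lt_of_eq_of_lt ?_ h5)
  have h6 := lp.norm_rpow_eq_tsum (p := 2) (by norm_num)
    ((⟨move w s a, sq_zero_iff_memℓp.1 ((ha.mob _ _ h3).zero)⟩ : lp (fun _ : D.I => ℂ) 2) - a)
  simp only [ENNReal.toReal_ofNat, Real.rpow_ofNat, lp.coeFn_sub] at h6
  exact h6

/-! ### Iterating moves and gaining decay -/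

/-- Infinitely many small corrections, each producing a new point `s` with the closed property
`Q s`, can be carried out in succession. -/
theorem exists_limit_of_step {E : Type*} [NormedAddCommGroup E] [CompleteSpace E]
    (Inv : E → Prop) (Q : ℂ → E → Prop) (S : Set ℂ) (hQ : ∀ s, IsClosed {x | Q s x})
    (hstep : ∀ x ε R, Inv x → 0 < ε → ∃ s ∈ S, R ≤ ‖s‖ ∧ ∃ y, Inv y ∧ ‖y - x‖ < ε ∧ Q s y ∧
      ∀ s', ‖s'‖ < R → Q s' x → Q s' y) {x₀ : E} (h0 : Inv x₀) (hx₀ : x₀ ≠ 0) :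
    ∃ x, x ≠ 0 ∧ ∀ R, ∃ s ∈ S, R ≤ ‖s‖ ∧ Q s x := by
  choose! σ hσS hσR Y hYI hYε hYQ hYp using hstep
  have hc : 0 < ‖x₀‖ := norm_pos_iff.2 hx₀
  -- These tolerances add up to `‖x₀‖ / 2`, so the limit cannot be zero.
  set e : ℕ → ℝ := fun n => ‖x₀‖ / 2 / 2 / 2 ^ n with he
  have he0 : ∀ n, 0 < e n := fun n => by positivity
  -- The second component exceeds the modulus of every point chosen so far, so later corrections
  -- preserve `Q` at all of them.
  let u : ℕ → E × ℝ := fun n => Nat.rec (x₀, 0)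
    (fun n p => (Y p.1 (e n) p.2, max (p.2 + 1) (‖σ p.1 (e n) p.2‖ + 1))) n
  have hu : ∀ n, u (n + 1) = (Y (u n).1 (e n) (u n).2,
    max ((u n).2 + 1) (‖σ (u n).1 (e n) (u n).2‖ + 1)) := fun n => rfl
  have hI : ∀ n, Inv (u n).1 := by
    intro n
    induction n with
    | zero => exact h0
    | succ n ih => rw [hu]; exact hYI _ _ _ ih (he0 n)
  have hmono : Monotone fun n => (u n).2 := by
    refine monotone_nat_of_le_succ fun n => ?_
    rw [hu]
    exact le_trans (by linarith) (le_max_left _ _)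
  have hlarge : ∀ n : ℕ, (n : ℝ) ≤ (u n).2 := by
    intro n
    induction n with
    | zero => simp [u]
    | succ n ih =>
      rw [hu]
      push_cast
      exact le_trans (by linarith) (le_max_left _ _)
  let s : ℕ → ℂ := fun n => σ (u n).1 (e n) (u n).2
  have hsu : ∀ n, ‖s n‖ < (u (n + 1)).2 := by
    intro n
    rw [hu]
    exact lt_of_lt_of_le (lt_add_one _) (le_max_right _ _)
  have hQall : ∀ n k, Q (s n) (u (n + 1 + k)).1 := by
    intro n k
    induction k with
    | zero => rw [add_zero, hu]; exact hYQ _ _ _ (hI n) (he0 n)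
    | succ k ih =>
      rw [← add_assoc, hu]
      refine hYp _ _ _ (hI _) (he0 _) _ ?_ ih
      exact (hsu n).trans_le (hmono (Nat.le_add_right (n + 1) k))
  have hdist : ∀ n, dist (u n).1 (u (n + 1)).1 ≤ ‖x₀‖ / 2 / 2 / 2 ^ n := by
    intro n
    rw [dist_comm, dist_eq_norm, hu]
    exact (hYε _ _ _ (hI n) (he0 n)).le
  have hcau : CauchySeq fun n => (u n).1 := cauchySeq_of_le_geometric_two hdist
  obtain ⟨x, hx⟩ := cauchySeq_tendsto_of_complete hcau
  refine ⟨x, ?_, fun R => ?_⟩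
  · rintro rfl
    have := dist_le_of_le_geometric_two_of_tendsto₀ hdist hx
    change dist x₀ 0 ≤ _ at this
    rw [dist_zero_right] at this
    linarith
  · obtain ⟨n, hn⟩ := exists_nat_ge R
    refine ⟨s n, hσS _ _ _ (hI n) (he0 n),
      (hn.trans (hlarge n)).trans (hσR _ _ _ (hI n) (he0 n)), ?_⟩
    refine (hQ (s n)).mem_of_tendsto hx ?_
    filter_upwards [eventually_ge_atTop (n + 1)] with k hk
    obtain ⟨j, rfl⟩ := Nat.exists_eq_add_of_le hk
    exact hQall n j

/-- Dividing by zeros makes the coefficients decay faster. -/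
theorem exists_weighted (Inv : (D.I → ℂ) → Prop) (h : ∀ x, D.Sq 0 x → Inv x →
      ∃ w, D.ct x w = 0 ∧ Van x w ∧ Inv (mulMob 0 1 w x)) (k : ℕ)
    {x : D.I → ℂ} (hx : D.Sq 0 x) (hI : Inv x) (h0 : x ≠ 0) :
    ∃ y : D.I → ℂ, D.Sq k y ∧ Inv y ∧ y ≠ 0 := by
  induction k with
  | zero => exact ⟨x, hx, hI, h0⟩
  | succ k ih =>
    obtain ⟨y, hy, hyI, hy0⟩ := ih
    obtain ⟨w, -, hw, hwI⟩ := h y hy.zero hyI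
    refine ⟨mulMob 0 1 w y, hy.mob_succ 1 hw, hwI, ?_⟩
    obtain ⟨m, hm⟩ := Function.ne_iff.1 hy0
    refine Function.ne_iff.2 ⟨m, ?_⟩
    have : w - D.t m ≠ 0 := fun h => hm (hw m (sub_eq_zero.1 h).symm)
    rw [mulMob, zero_add]
    exact mul_ne_zero hm (one_div_ne_zero this)

/-! ### Separated zeros and pairs of zeros -/

/-- `w` is a zero of the Cauchy transform, and the coefficients vanish at all `n` for which `tₙ`
is at distance less than `r n` from `w`. -/
def SepZero (r : D.I → ℝ) (x : D.I → ℂ) (w : ℂ) : Prop :=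
  D.ct x w = 0 ∧ ∀ n, ‖w - D.t n‖ < r n → x n = 0

/-- `w` and `w'` are two zeros of the Cauchy transform, or, if they are equal, a double zero. -/
def PairZero (x : D.I → ℂ) (w w' : ℂ) : Prop :=
  D.ct x w = 0 ∧ D.ct x w' = 0 ∧ D.ct (mulMob 0 1 w x) w' = 0

/-- Two zeros off `T` that are separated from all points of `T` but `tₘ`. -/
def NearPair (r : D.I → ℝ) (x : D.I → ℂ) (w w' : ℂ) (m : D.I) : Prop :=
  w ∉ D.T ∧ w' ∉ D.T ∧ PairZero x w w' ∧
    (∀ n, n ≠ m → r n ≤ ‖w - D.t n‖ ∧ r n ≤ ‖w' - D.t n‖) ∧ ‖w‖ ≤ 2 * |D.t m|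

theorem van_of_notMem {x : D.I → ℂ} {w : ℂ} (h : w ∉ D.T) : Van x w :=
  fun n hn => absurd ⟨n, hn⟩ h

theorem SepZero.van {r : D.I → ℝ} (hr : ∀ n, 0 < r n) {x : D.I → ℂ} {w : ℂ}
    (h : SepZero r x w) : Van x w := by
  intro n hn
  refine h.2 n ?_
  rw [hn, sub_self, norm_zero]
  exact hr n

theorem SepZero.mob {r : D.I → ℝ} (hr : ∀ n, 0 < r n) {x : D.I → ℂ} (hx : D.Sq 0 x) {u w : ℂ}
    (κ l : ℂ) (hu : D.ct x u = 0) (hxu : Van x u) (hne : w ≠ u) (h : SepZero r x w) :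
    SepZero r (mulMob κ l u x) w := by
  refine ⟨?_, fun n hn => ?_⟩
  · rw [ct_mob hx κ l hu hxu (h.van hr) hne, h.1, mul_zero]
  · rw [mulMob, h.2 n hn, zero_mul]

/-- Dividing by `w` commutes with the multiplication at `u`, and `u` remains a zero after that
division, so `ct_mob` applies to the divided transform as well. -/
theorem PairZero.mob {x : D.I → ℂ} (hx : D.Sq 0 x) {u w w' : ℂ} (κ l : ℂ) (hu : D.ct x u = 0)
    (hxu : Van x u) (hw : Van x w) (hw' : Van x w') (hne : w ≠ u) (hne' : w' ≠ u)
    (h : PairZero x w w') : PairZero (mulMob κ l u x) w w' := by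
  refine ⟨?_, ?_, ?_⟩
  · rw [ct_mob hx κ l hu hxu hw hne, h.1, mul_zero]
  · rw [ct_mob hx κ l hu hxu hw' hne', h.2.1, mul_zero]
  · have h1 : D.ct (mulMob 0 1 w x) u = 0 := by
      rw [ct_mob hx 0 1 h.1 hw hxu hne.symm, hu, mul_zero]
    rw [mob_comm, ct_mob (hx.mob 0 1 hw) κ l h1 (hxu.mob 0 1 w) (hw'.mob 0 1 w) hne', h.2.2,
      mul_zero]

/-- Unlike `ct_mob`, this covers `w' = w`: the product is a combination of the transform and its
quotient by `w - z`, both zero at `w'`. -/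
theorem PairZero.ct_mob_eq_zero {x : D.I → ℂ} (hx : D.Sq 0 x) {w w' : ℂ} (hw : Van x w)
    (h : PairZero x w w') (κ l : ℂ) : D.ct (mulMob κ l w x) w' = 0 := by
  have h1 := ((summable_ct hx w').mul_left κ).tsum_add
    ((summable_ct (hx.mob 0 1 hw) w').mul_left l)
  rw [tsum_mul_left, tsum_mul_left] at h1
  change _ = κ * D.ct x w' + l * D.ct (mulMob 0 1 w x) w' at h1
  rw [h.2.1, h.2.2, mul_zero, mul_zero, add_zero] at h1
  rw [← h1]
  refine tsum_congr fun n => ?_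
  simp only [mulMob]
  ring

/-- There are separated zeros of arbitrarily large modulus in `V`. -/
def ManySep (V : Set ℂ) (r : D.I → ℝ) (x : D.I → ℂ) : Prop :=
  ∀ R : ℝ, ∃ w ∈ V, R ≤ ‖w‖ ∧ SepZero r x w

/-- There are pairs of zeros of arbitrarily large modulus close to points of `T`. -/
def ManyPairs (r : D.I → ℝ) (x : D.I → ℂ) : Prop :=
  ∀ R : ℝ, ∃ w w' m, R ≤ ‖w‖ ∧ R ≤ ‖w'‖ ∧ NearPair r x w w' m

theorem ne_of_norm_lt {u w : ℂ} {R : ℝ} (h : max R (‖u‖ + 1) ≤ ‖w‖) : w ≠ u := by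
  rintro rfl
  have := (le_max_right R (‖w‖ + 1)).trans h
  linarith

theorem ManySep.mob {V : Set ℂ} {r : D.I → ℝ} (hr : ∀ n, 0 < r n) {x : D.I → ℂ} (hx : D.Sq 0 x)
    {u : ℂ} (κ l : ℂ) (hu : D.ct x u = 0) (hxu : Van x u) (h : ManySep V r x) :
    ManySep V r (mulMob κ l u x) := by
  intro R
  obtain ⟨w, hV, hw, h1⟩ := h (max R (‖u‖ + 1))
  exact ⟨w, hV, (le_max_left _ _).trans hw, h1.mob hr hx κ l hu hxu (ne_of_norm_lt hw)⟩

theorem ManyPairs.mob {r : D.I → ℝ} {x : D.I → ℂ} (hx : D.Sq 0 x)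
    {u : ℂ} (κ l : ℂ) (hu : D.ct x u = 0) (hxu : Van x u) (h : ManyPairs r x) :
    ManyPairs r (mulMob κ l u x) := by
  intro R
  obtain ⟨w, w', m, hw, hw', h1, h2, h3, h4⟩ := h (max R (‖u‖ + 1))
  exact ⟨w, w', m, (le_max_left _ _).trans hw, (le_max_left _ _).trans hw', h1, h2,
    h3.mob hx κ l hu hxu (van_of_notMem h1) (van_of_notMem h2) (ne_of_norm_lt hw)
      (ne_of_norm_lt hw'), h4⟩

theorem ManySep.exists_weighted {V : Set ℂ} {r : D.I → ℝ} (hr : ∀ n, 0 < r n) {x : D.I → ℂ}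
    (hx : D.Sq 0 x) (h0 : x ≠ 0) (h : ManySep V r x) (k : ℕ) :
    ∃ a : lp (fun _ : D.I => ℂ) 2, (D.Sq k a ∧ ManySep V r a) ∧ a ≠ 0 := by
  obtain ⟨y, hy, hyI, hy0⟩ := CauchyData.exists_weighted (ManySep V r) (fun x hx hI => by
    obtain ⟨w, -, -, hw⟩ := hI 0
    exact ⟨w, hw.1, hw.van hr, hI.mob hr hx 0 1 hw.1 (hw.van hr)⟩) k hx h h0
  exact ⟨⟨y, sq_zero_iff_memℓp.1 hy.zero⟩, ⟨hy, hyI⟩, fun h => hy0 (congrArg Subtype.val h)⟩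

theorem ManyPairs.exists_weighted {r : D.I → ℝ} {x : D.I → ℂ}
    (hx : D.Sq 0 x) (h0 : x ≠ 0) (h : ManyPairs r x) (k : ℕ) :
    ∃ a : lp (fun _ : D.I => ℂ) 2, (D.Sq k a ∧ ManyPairs r a) ∧ a ≠ 0 := by
  obtain ⟨y, hy, hyI, hy0⟩ := CauchyData.exists_weighted (ManyPairs r) (fun x hx hI => by
    obtain ⟨w, w', m, -, -, hw, -, hz, -⟩ := hI 0
    exact ⟨w, hz.1, van_of_notMem hw, hI.mob hx 0 1 hz.1 (van_of_notMem hw)⟩) k hx h h0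
  exact ⟨⟨y, sq_zero_iff_memℓp.1 hy.zero⟩, ⟨hy, hyI⟩, fun h => hy0 (congrArg Subtype.val h)⟩

theorem isClosed_and {X : Type*} [TopologicalSpace X] {p q : X → Prop} (hp : IsClosed {x | p x})
    (hq : IsClosed {x | q x}) : IsClosed {x | p x ∧ q x} := hp.inter hq

theorem isClosed_coeffs_eq_zero (P : D.I → Prop) :
    IsClosed {a : lp (fun _ : D.I => ℂ) 2 | ∀ n, P n → a n = 0} := by
  have : {a : lp (fun _ : D.I => ℂ) 2 | ∀ n, P n → a n = 0} =
      ⋂ n, ⋂ _ : P n, {a : lp (fun _ : D.I => ℂ) 2 | a n = 0} := by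
    ext a
    simp
  rw [this]
  exact isClosed_iInter fun n => isClosed_iInter fun _ => isClosed_coeff_eq_zero n

theorem isClosed_sepZero (r : D.I → ℝ) (w : ℂ) :
    IsClosed {a : lp (fun _ : D.I => ℂ) 2 | SepZero r a w}  :=
  isClosed_and (isClosed_ct_eq_zero w) (isClosed_coeffs_eq_zero fun n => ‖w - D.t n‖ < r n)

/-- For `w` off `T` the divided transform at `w` is again a pairing with a fixed square summable
sequence. -/
theorem isClosed_pairZero {w : ℂ} (hw : w ∉ D.T) :
    IsClosed {a : lp (fun _ : D.I => ℂ) 2 | PairZero (D := D) a w w} := by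
  refine isClosed_and (isClosed_ct_eq_zero w) (isClosed_and (isClosed_ct_eq_zero w) ?_)
  have hv : D.Sq 0 (mulMob 0 1 w fun n => (Real.sqrt (D.mass n) : ℂ) / (w - D.t n)) := by
    refine Sq.mob (k := 0) ?_ 0 1 (van_of_notMem hw)
    simpa [Sq] using D.summable_kernel_sq w
  have h1 := isClosed_tsum_mul_eq_zero (by simpa [Sq] using hv)
  have h2 : ∀ a : lp (fun _ : D.I => ℂ) 2, D.ct (mulMob 0 1 w a) w = ∑' n, a n *
      mulMob 0 1 w (fun n => (Real.sqrt (D.mass n) : ℂ) / (w - D.t n)) n := by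
    intro a
    refine tsum_congr fun n => ?_
    simp only [mulMob]
    ring
  simpa only [h2] using h1

/-! ### Constructing functions with prescribed zeros -/

section
variable {N : ℕ} {δ : ℝ} {r : D.I → ℝ}

theorem ManySep.exists_zeros_in (hδ : 0 < δ) (hr : ∀ n, δ / (1 + |D.t n|) ^ N ≤ r n)
    {x : D.I → ℂ} (hx : D.Sq 0 x) (h0 : x ≠ 0) (h : ManySep Set.univ r x)
    {S : Set ℂ} (hS : ∀ R, ∃ s ∈ S, R ≤ ‖s‖) :
    ∃ a : lp (fun _ : D.I => ℂ) 2, a ≠ 0 ∧ ∀ R, ∃ s ∈ S, R ≤ ‖s‖ ∧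
      (s ∉ D.T → D.ct a s = 0) ∧ Van (D := D) a s := by
  have hr0 : ∀ n, 0 < r n := fun n => lt_of_lt_of_le (by positivity) (hr n)
  obtain ⟨x₀, hI, hx₀⟩ := h.exists_weighted hr0 hx h0 (N + 1)
  refine exists_limit_of_step (fun a : lp (fun _ : D.I => ℂ) 2 =>
    D.Sq (N + 1) a ∧ ManySep Set.univ r a) (fun s a => (s ∉ D.T → D.ct a s = 0) ∧ Van (D := D) a s)
    S (fun s => ?_) ?_ hI hx₀
  · refine isClosed_and ?_ (isClosed_coeffs_eq_zero fun n => (D.t n : ℂ) = s)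
    by_cases hs : s ∈ D.T
    · simp [hs]
    · simpa [hs] using isClosed_ct_eq_zero s
  · rintro a ε R ⟨ha, hm⟩ hε
    obtain ⟨ρ, hρ⟩ := exists_move hδ ha hε
    obtain ⟨w, -, hwR, hw⟩ := hm (max R (max ρ 0))
    -- Choosing `s` beyond `w` ensures both `‖w‖ ≤ 2 * ‖s‖` and `s ≠ w`.
    obtain ⟨s, hsS, hs⟩ := hS (‖w‖ + 1)
    have hwv := hw.van hr0
    have hR : R ≤ ‖w‖ := (le_max_left _ _).trans hwR
    obtain ⟨b, hb, hbε⟩ := hρ w s ((le_max_left _ _).trans ((le_max_right _ _).trans hwR))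
      (by linarith [norm_nonneg w]) hwv fun n hn _ =>
        (hr n).trans (not_lt.1 fun h => hn (hw.2 n h))
    have hsw : s ≠ w := by
      rintro rfl
      linarith
    have hs0 : s ≠ 0 := norm_pos_iff.1 (by linarith [norm_nonneg w])
    have hws : w - s ≠ 0 := sub_ne_zero.2 hsw.symm
    have hfac := move_factor_self hsw
    refine ⟨s, hsS, by linarith, b, ⟨?_, ?_⟩, hbε, ⟨fun hsT => ?_, ?_⟩, ?_⟩
    · rw [hb]; exact ha.mob _ _ hwv
    · rw [hb]; exact hm.mob hr0 ha.zero _ _ hw.1 hwv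
    · rw [hb, move, ct_mob ha.zero _ _ hw.1 hwv (van_of_notMem hsT) hsw, hfac, zero_mul]
    · intro n hn
      rw [hb, move, mulMob, hn, hfac, mul_zero]
    · rintro s' hs' ⟨h1, h2⟩
      rw [hb]
      refine ⟨fun hT => ?_, h2.mob _ _ _⟩
      rw [move, ct_mob ha.zero _ _ hw.1 hwv h2 (by rintro rfl; linarith), h1 hT, mul_zero]

/-- Here the target of each move is another zero of the same function, which thereby becomes double.
-/
theorem ManySep.exists_double_zeros (hδ : 0 < δ) (hr : ∀ n, δ / (1 + |D.t n|) ^ N ≤ r n)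
    {x : D.I → ℂ} (hx : D.Sq 0 x) (h0 : x ≠ 0) (h : ManySep D.Tᶜ r x) :
    ∃ a : lp (fun _ : D.I => ℂ) 2, a ≠ 0 ∧ ∀ R, ∃ s ∈ D.Tᶜ, R ≤ ‖s‖ ∧
      (s ∉ D.T ∧ PairZero (D := D) a s s) := by
  have hr0 : ∀ n, 0 < r n := fun n => lt_of_lt_of_le (by positivity) (hr n)
  obtain ⟨x₀, hI, hx₀⟩ := h.exists_weighted hr0 hx h0 (N + 1)
  refine exists_limit_of_step (fun a : lp (fun _ : D.I => ℂ) 2 =>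
    D.Sq (N + 1) a ∧ ManySep D.Tᶜ r a) (fun s a => s ∉ D.T ∧ PairZero (D := D) a s s)
    D.Tᶜ (fun s => ?_) ?_ hI hx₀
  · by_cases hs : s ∈ D.T
    · simp [hs]
    · simpa [hs] using isClosed_pairZero hs
  · rintro a ε R ⟨ha, hm⟩ hε
    obtain ⟨ρ, hρ⟩ := exists_move hδ ha hε
    obtain ⟨w, hwT, hwR, hw⟩ := hm (max R (max ρ 0))
    obtain ⟨s, hsT, hs, hsz⟩ := hm (‖w‖ + 1)
    have hwv := hw.van hr0
    have hsv := hsz.van hr0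
    have hR : R ≤ ‖w‖ := (le_max_left _ _).trans hwR
    obtain ⟨b, hb, hbε⟩ := hρ w s ((le_max_left _ _).trans ((le_max_right _ _).trans hwR))
      (by linarith [norm_nonneg w]) hwv fun n hn _ =>
        (hr n).trans (not_lt.1 fun h => hn (hw.2 n h))
    have hsw : s ≠ w := by
      rintro rfl
      linarith
    have hs0 : s ≠ 0 := norm_pos_iff.1 (by linarith [norm_nonneg w])
    have hbs : D.ct b s = 0 := by
      rw [hb, move, ct_mob ha.zero _ _ hw.1 hwv hsv hsw, hsz.1, mul_zero]
    refine ⟨s, hsT, by linarith, b, ⟨?_, ?_⟩, hbε, ⟨hsT, hbs, hbs, ?_⟩, ?_⟩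
    · rw [hb]; exact ha.mob _ _ hwv
    · rw [hb]; exact hm.mob hr0 ha.zero _ _ hw.1 hwv
    -- The factor `s - t` gained in the move cancels on division, leaving `a` divided by `w - t` up
    -- to the constant `w / s`; that transform still vanishes at `s`.
    · have h1 : mulMob 0 1 s b = mulMob 0 (w / s) w a := by
        funext n
        have h2 : s - D.t n ≠ 0 := fun h => hsT ⟨n, (sub_eq_zero.1 h).symm⟩
        have h3 : w - D.t n ≠ 0 := fun h => hwT ⟨n, (sub_eq_zero.1 h).symm⟩
        rw [hb]
        simp only [move, mulMob]
        field_simp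
        ring
      rw [h1, ct_mob ha.zero _ _ hw.1 hwv hsv hsw, hsz.1, mul_zero]
    · rintro s' hs' ⟨h1, h2⟩
      have hne : s' ≠ w := by rintro rfl; linarith
      rw [hb]
      exact ⟨h1, h2.mob ha.zero _ _ hw.1 hwv (van_of_notMem h1) (van_of_notMem h1) hne hne⟩

/-- Moving `w` to `tₘ` annihilates the coefficient at `m`, the only one that kept `w'` from being
separated. -/
theorem ManyPairs.exists_manySep (hδ : 0 < δ) (hr : ∀ n, δ / (1 + |D.t n|) ^ N ≤ r n)
    {x : D.I → ℂ} (hx : D.Sq 0 x) (h0 : x ≠ 0) (h : ManyPairs r x) :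
    ∃ a : lp (fun _ : D.I => ℂ) 2, a ≠ 0 ∧ ManySep (D := D) Set.univ r a := by
  have hr0 : ∀ n, 0 < r n := fun n => lt_of_lt_of_le (by positivity) (hr n)
  obtain ⟨x₀, hI, hx₀⟩ := h.exists_weighted hx h0 (N + 1)
  refine exists_limit_of_step (fun a : lp (fun _ : D.I => ℂ) 2 =>
    D.Sq (N + 1) a ∧ ManyPairs r a) (fun s a => SepZero r a s)
    Set.univ (isClosed_sepZero r) ?_ hI hx₀
  rintro a ε R ⟨ha, hm⟩ hε
  obtain ⟨ρ, hρ⟩ := exists_move hδ ha hε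
  obtain ⟨w, w', m, hwR, hwR', hwT, hwT', hz, hsep, hwm⟩ := hm (max R (max ρ 0))
  have hwv : Van a w := van_of_notMem hwT
  have hR : R ≤ ‖w‖ := (le_max_left _ _).trans hwR
  obtain ⟨b, hb, hbε⟩ := hρ w (D.t m) ((le_max_left _ _).trans ((le_max_right _ _).trans hwR))
    (by simpa using hwm) hwv fun n _ hn =>
      (hr n).trans (hsep n fun h => hn (by rw [h])).1
  have hmw : (D.t m : ℂ) ≠ w := fun h => hwT ⟨m, h⟩
  refine ⟨w', trivial, (le_max_left _ _).trans hwR', b, ⟨?_, ?_⟩, hbε, ⟨?_, fun n hn => ?_⟩, ?_⟩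
  · rw [hb]; exact ha.mob _ _ hwv
  · rw [hb]; exact hm.mob ha.zero _ _ hz.1 hwv
  · rw [hb]; exact hz.ct_mob_eq_zero ha.zero hwv _ _
  · by_cases hnm : n = m
    · rw [hb, move, mulMob, hnm, move_factor_self hmw, mul_zero]
    · exact absurd hn (not_lt.2 (hsep n hnm).2)
  · intro s' hs' h1
    rw [hb]
    exact h1.mob hr0 ha.zero _ _ hz.1 hwv (by rintro rfl; linarith)

/-- Separated zeros or pairs of zeros close to points of `T`, of arbitrarily large modulus, can be
moved to any unbounded set. -/
theorem exists_zeros_in (hδ : 0 < δ) (hr : ∀ n, δ / (1 + |D.t n|) ^ N ≤ r n)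
    {x : D.I → ℂ} (hx : D.Sq 0 x) (h0 : x ≠ 0)
    (h : ∀ R : ℝ, (∃ w, R ≤ ‖w‖ ∧ SepZero r x w) ∨
      ∃ w w' m, R ≤ ‖w‖ ∧ R ≤ ‖w'‖ ∧ NearPair r x w w' m)
    {S : Set ℂ} (hS : ∀ R, ∃ s ∈ S, R ≤ ‖s‖) :
    ∃ a : lp (fun _ : D.I => ℂ) 2, a ≠ 0 ∧ ∀ R, ∃ s ∈ S, R ≤ ‖s‖ ∧
      (s ∉ D.T → D.ct a s = 0) ∧ Van (D := D) a s := by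
  by_cases hm : ManySep Set.univ r x
  · exact hm.exists_zeros_in hδ hr hx h0 hS
  · have hp : ManyPairs r x := by
      simp only [ManySep, not_forall] at hm
      obtain ⟨R₀, hR₀⟩ := hm
      intro R
      rcases h (max R R₀) with ⟨w, hw, hz⟩ | ⟨w, w', m, hw, hw', hz⟩
      · exact absurd ⟨w, trivial, (le_max_right _ _).trans hw, hz⟩ hR₀
      · exact ⟨w, w', m, (le_max_left _ _).trans hw, (le_max_left _ _).trans hw', hz⟩
    obtain ⟨a, ha, hsep⟩ := hp.exists_manySep hδ hr hx h0
    exact hsep.exists_zeros_in hδ hr (sq_zero_coe a)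
      (fun h => ha (Subtype.ext h)) hS

end

/-! ### Radii and the zero set in terms of coefficients -/

/-- Monotonicity reduces to adjacent indices. The factor 4 is slack: it makes the disks disjoint and
keeps each of them away from the other points of `T`. -/
theorem PowerSeparated.exists_radii (hT : D.PowerSeparated) : ∃ δ > 0, δ ≤ 1 / 4 ∧ ∃ N : ℕ,
    ∀ n k : D.I, n ≠ k → 4 * (δ / (1 + |D.t n|) ^ N) ≤ |D.t n - D.t k| := by
  obtain ⟨C, hC, N, h⟩ := hT
  have hc : 0 < min C 1 := lt_min hC one_pos
  refine ⟨min C 1 / 4, by positivity, by linarith [min_le_right C 1], N, fun n k hnk => ?_⟩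
  have hpos : 0 < (1 + |D.t n|) ^ N := by positivity
  have hgoal : 4 * (min C 1 / 4 / (1 + |D.t n|) ^ N) = min C 1 / (1 + |D.t n|) ^ N := by ring
  rw [hgoal]
  have key : ∀ p : D.I, |D.t p| ≤ 1 + |D.t n| →
      min C 1 / (1 + |D.t n|) ^ N ≤ C * (|D.t p| ^ N)⁻¹ := by
    intro p hp
    have := abs_pos.2 (D.t_ne_zero p)
    rw [div_eq_mul_inv]
    gcongr
    exact min_le_left _ _
  have hle : min C 1 / (1 + |D.t n|) ^ N ≤ 1 := by
    rw [div_le_one hpos]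
    exact (min_le_right _ _).trans (one_le_pow₀ (by linarith [abs_nonneg (D.t n)]))
  have hmono := D.strictMono_t.monotone
  rcases lt_or_gt_of_ne hnk with hlt | hlt
  · have hlt' : (n : ℤ) < k := hlt
    let p : D.I := ⟨n + 1, D.ordConnected_I.out n.2 k.2 ⟨by lia, by lia⟩⟩
    have hnp : n < p := by
      change (n : ℤ) < n + 1
      lia
    have h1 := h n p rfl
    have h2 : D.t p ≤ D.t k := hmono (by change (n : ℤ) + 1 ≤ k; lia)
    have h3 := D.strictMono_t hnp
    rw [abs_of_pos (sub_pos.2 h3)] at h1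
    rw [abs_of_neg (sub_neg.2 (h3.trans_le h2))]
    linarith [key n (by linarith)]
  · have hlt' : (k : ℤ) < n := hlt
    let p : D.I := ⟨n - 1, D.ordConnected_I.out k.2 n.2 ⟨by lia, by lia⟩⟩
    have hnp : p < n := by
      change (n : ℤ) - 1 < n
      lia
    have h1 := h p n (by change (n : ℤ) = n - 1 + 1; lia)
    have h2 : D.t k ≤ D.t p := hmono (by change (k : ℤ) ≤ n - 1; lia)
    have h3 := D.strictMono_t hnp
    rw [abs_of_pos (sub_pos.2 h3)] at h1
    rw [abs_of_pos (sub_pos.2 (h2.trans_lt h3))]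
    -- The gap below `tₙ` is bounded in terms of `tₚ`, not `tₙ`; if it is shorter than 1, the two
    -- moduli are comparable.
    by_cases hg : 1 ≤ D.t n - D.t p
    · linarith
    · have h4 : |D.t p| ≤ 1 + |D.t n| := by
        have := abs_sub_abs_le_abs_sub (D.t p) (D.t n)
        rw [abs_of_neg (sub_neg.2 h3)] at this
        linarith
      linarith [key p h4]

theorem norm_t_sub_t (n k : D.I) : ‖(D.t n : ℂ) - D.t k‖ = |D.t n - D.t k| := by
  rw [← Complex.ofReal_sub, Complex.norm_real, Real.norm_eq_abs]

theorem coeffEqZero_iff (a : lp (fun _ : D.I => ℂ) 2) (n : D.I) :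
    D.CoeffEqZero (D.ct a) n ↔ a n = 0 := by
  refine ⟨?_, fun h => ⟨a, rfl, h⟩⟩
  rintro ⟨b, hb, hn⟩
  rw [← eq_of_ct_eq (sq_zero_coe b) (sq_zero_coe a) hb]
  exact hn

theorem mem_zeroSet_iff {a : lp (fun _ : D.I => ℂ) 2} {w : ℂ} : w ∈ D.zeroSet (D.ct a) ↔
    (w ∉ D.T ∧ D.ct a w = 0) ∨ ∃ n, w = (D.t n : ℂ) ∧ a n = 0 := by
  simp only [zeroSet, Set.mem_union, Set.mem_ofPred_eq, coeffEqZero_iff]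

theorem coe_ne_zero {a : lp (fun _ : D.I => ℂ) 2} (ha : a ≠ 0) : (a : D.I → ℂ) ≠ 0 :=
  fun h => ha (Subtype.ext h)

theorem ct_ne_zero {a : lp (fun _ : D.I => ℂ) 2} (ha : a ≠ 0) : D.ct a ≠ 0 :=
  fun h => coe_ne_zero ha (eq_zero_of_ct_eq_zero (sq_zero_coe a) h)

theorem ne_zero_of_ct_ne_zero {a : lp (fun _ : D.I => ℂ) 2} (ha : D.ct a ≠ 0) : a ≠ 0 := by
  rintro rfl
  refine ha (funext fun z => ?_)
  simp [ct]

theorem finite_zeroSet_le {a : lp (fun _ : D.I => ℂ) 2} (ha : a ≠ 0) (R : ℝ) :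
    {w ∈ D.zeroSet (D.ct a) | ‖w‖ ≤ R}.Finite := by
  refine ((finite_ct_zeros (sq_zero_coe a) (coe_ne_zero ha) R).union
    ((finite_t_le (D := D) R).image fun n => (D.t n : ℂ))).subset ?_
  rintro w ⟨hw, hR⟩
  rcases mem_zeroSet_iff.1 hw with ⟨-, h⟩ | ⟨n, rfl, -⟩
  · exact Or.inl ⟨h, hR⟩
  · exact Or.inr ⟨n, by simpa using hR, rfl⟩

theorem exists_large_of_infinite {a : lp (fun _ : D.I => ℂ) 2} (ha : a ≠ 0) {A : Set ℂ}
    (hA : A.Infinite) (hsub : A ⊆ D.zeroSet (D.ct a)) (R : ℝ) : ∃ w ∈ A, R ≤ ‖w‖ := by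
  by_contra! h
  exact hA ((finite_zeroSet_le ha R).subset fun w hw => ⟨hsub hw, (h w hw).le⟩)

theorem not_isBounded_iff {S : Set ℂ} :
    ¬ Bornology.IsBounded S ↔ ∀ R : ℝ, ∃ s ∈ S, R ≤ ‖s‖ := by
  rw [isBounded_iff_forall_norm_le]
  push Not
  refine ⟨fun h R => ?_, fun h R => ?_⟩
  · obtain ⟨s, hs, h1⟩ := h R
    exact ⟨s, hs, h1.le⟩
  · obtain ⟨s, hs, h1⟩ := h (R + 1)
    exact ⟨s, hs, by linarith⟩

theorem infinite_of_exists_large {A : Set ℂ} (h : ∀ R : ℝ, ∃ s ∈ A, R ≤ ‖s‖) : A.Infinite :=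
  fun hfin => not_isBounded_iff.2 h hfin.isBounded

theorem exists_large_t (R : ℝ) : ∃ n : D.I, R ≤ |D.t n| := by
  have := D.infinite_I.to_subtype
  exact (D.tendsto_t.eventually (eventually_ge_atTop R)).exists

theorem eventually_notMem_T {p : ℂ} (hp : p ∉ D.T) : ∀ᶠ z in nhds p, z ∉ D.T := by
  obtain ⟨C, -, ρ, hρ, h⟩ := D.exists_kernel_bound p
  filter_upwards [Metric.ball_mem_nhds p hρ] with z hz
  rintro ⟨n, rfl⟩
  have := h n (fun hn => hp ⟨n, hn⟩) _ hz
  rw [sub_self, norm_zero, mul_zero] at this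
  linarith [abs_nonneg (D.t n)]

/-! ### Double zeros and analytic order -/

/-- Writing the transform as `(z - w) ^ 2 * g`, its quotient by `w - z` is `-(z - w) * g` near `w`,
which tends to 0; continuity gives the value at `w`. -/
theorem pairZero_of_two_le_order {x : D.I → ℂ} (hx : D.Sq 0 x) {w : ℂ} (hw : w ∉ D.T)
    (h : 2 ≤ analyticOrderAt (D.ct x) w) : PairZero x w w := by
  have hv : Van x w := van_of_notMem hw
  obtain ⟨g, hg, hgw⟩ := (natCast_le_analyticOrderAt (n := 2) (analyticAt_ct hx hv)).1 h
  have h0 : D.ct x w = 0 := by simpa using hgw.self_of_nhds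
  refine ⟨h0, h0, ?_⟩
  have h1 : Tendsto (D.ct (mulMob 0 1 w x)) (nhdsWithin w {w}ᶜ)
      (nhds (D.ct (mulMob 0 1 w x) w)) :=
    (analyticAt_ct (hx.mob 0 1 hv) (hv.mob 0 1 w)).continuousAt.tendsto.mono_left
      nhdsWithin_le_nhds
  have h2 : Tendsto (fun z => -(z - w) * g z) (nhdsWithin w {w}ᶜ) (nhds (-(w - w) * g w)) := by
    have hc : ContinuousAt (fun z => -(z - w) * g z) w := by
      have := hg.continuousAt
      fun_prop
    exact hc.tendsto.mono_left nhdsWithin_le_nhds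
  rw [sub_self, neg_zero, zero_mul] at h2
  refine tendsto_nhds_unique h1 (h2.congr' ?_)
  filter_upwards [self_mem_nhdsWithin, nhdsWithin_le_nhds hgw,
    nhdsWithin_le_nhds (eventually_notMem_T hw)] with z hz hgz hzT
  have hz' : w - z ≠ 0 := sub_ne_zero.2 (Ne.symm hz)
  rw [ct_mob hx 0 1 h0 hv (van_of_notMem hzT) hz, hgz, smul_eq_mul]
  field_simp
  ring

theorem PairZero.two_le_order {x : D.I → ℂ} (hx : D.Sq 0 x) {w : ℂ} (hw : w ∉ D.T)
    (h : PairZero x w w) : 2 ≤ analyticOrderAt (D.ct x) w := by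
  have hv : Van x w := van_of_notMem hw
  have hx1 := hx.mob 0 1 hv
  refine (natCast_le_analyticOrderAt (n := 2) (analyticAt_ct hx hv)).2
    ⟨D.ct (mulMob 0 1 w (mulMob 0 1 w x)), analyticAt_ct (hx1.mob 0 1 (hv.mob 0 1 w))
      ((hv.mob 0 1 w).mob 0 1 w), ?_⟩
  filter_upwards [eventually_notMem_T hw] with z hzT
  have hvz : Van x z := van_of_notMem hzT
  by_cases hz : z = w
  · simp [hz, h.1]
  · have hz' : w - z ≠ 0 := sub_ne_zero.2 (Ne.symm hz)
    rw [ct_mob hx1 0 1 h.2.2 (hv.mob 0 1 w) (hvz.mob 0 1 w) hz, ct_mob hx 0 1 h.1 hv hvz hz,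
      smul_eq_mul]
    field_simp
    ring

theorem multipleZeroSet_subset (f : ℂ → ℂ) : D.multipleZeroSet f ⊆ D.zeroSet f := by
  rintro w (⟨hw, h⟩ | ⟨n, rfl, h, -⟩)
  · refine Or.inl ⟨hw, apply_eq_zero_of_analyticOrderAt_ne_zero fun h0 => ?_⟩
    rw [h0] at h
    exact absurd h (by norm_num)
  · exact Or.inr ⟨n, rfl, h⟩

/-! ### Zeros inside the disks -/

section
variable {r : D.I → ℝ}

theorem le_norm_sub_of_mem_disk (hr0 : ∀ n, 0 < r n)
    (hsep : ∀ n k, n ≠ k → 4 * r n ≤ |D.t n - D.t k|) {w : ℂ}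
    {m n : D.I} (hw : w ∈ D.disk m (r m)) (hnm : n ≠ m) : r n ≤ ‖w - D.t n‖ := by
  have h1 : ‖w - D.t m‖ < r m := mem_ball_iff_norm.1 hw
  have h2 := hsep n m hnm
  have h3 := hsep m n hnm.symm
  rw [abs_sub_comm, ← norm_t_sub_t] at h2
  rw [← norm_t_sub_t] at h3
  have h4 : ‖(D.t m : ℂ) - D.t n‖ ≤ ‖w - D.t n‖ + ‖w - D.t m‖ := by
    have : (D.t m : ℂ) - D.t n = (w - D.t n) - (w - D.t m) := by ring
    rw [this]
    exact norm_sub_le _ _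
  linarith [hr0 n, hr0 m]

theorem sepZero_of_notMem_disks {x : D.I → ℂ} {w : ℂ}
    (hw : ∀ n, w ∉ D.disk n (r n)) (h : D.ct x w = 0) : SepZero r x w :=
  ⟨h, fun n hn => absurd (mem_ball_iff_norm.2 hn) (hw n)⟩

theorem sepZero_of_mem_disk (hr0 : ∀ n, 0 < r n)
    (hsep : ∀ n k, n ≠ k → 4 * r n ≤ |D.t n - D.t k|) {x : D.I → ℂ} {w : ℂ} {m : D.I}
    (hw : w ∈ D.disk m (r m)) (h : D.ct x w = 0) (hm : x m = 0) : SepZero r x w := by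
  refine ⟨h, fun n hn => ?_⟩
  by_cases hnm : n = m
  · rwa [hnm]
  · exact absurd hn (not_lt.2 (le_norm_sub_of_mem_disk hr0 hsep hw hnm))

theorem eq_of_t_mem_disk (hr0 : ∀ n, 0 < r n)
    (hsep : ∀ n k, n ≠ k → 4 * r n ≤ |D.t n - D.t k|) {n m : D.I}
    (h : (D.t n : ℂ) ∈ D.disk m (r m)) : n = m := by
  by_contra hnm
  have := le_norm_sub_of_mem_disk hr0 hsep h hnm
  rw [sub_self, norm_zero] at this
  linarith [hr0 n]

theorem nearPair_of_mem_disk (hr0 : ∀ n, 0 < r n) (hr1 : ∀ n, r n ≤ 1)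
    (hsep : ∀ n k, n ≠ k → 4 * r n ≤ |D.t n - D.t k|) {x : D.I → ℂ} {w w' : ℂ} {m : D.I}
    (hm : 1 ≤ |D.t m|) (hw : w ∈ D.disk m (r m)) (hw' : w' ∈ D.disk m (r m)) (hwT : w ∉ D.T)
    (hwT' : w' ∉ D.T) (h : PairZero x w w') : NearPair r x w w' m := by
  refine ⟨hwT, hwT', h, fun n hn => ⟨le_norm_sub_of_mem_disk hr0 hsep hw hn,
    le_norm_sub_of_mem_disk hr0 hsep hw' hn⟩, ?_⟩
  have h1 : ‖w - D.t m‖ < r m := mem_ball_iff_norm.1 hw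
  have h2 := norm_sub_norm_le w (D.t m : ℂ)
  rw [Complex.norm_real, Real.norm_eq_abs] at h2
  linarith [hr1 m]

theorem le_norm_of_mem_disk (hr1 : ∀ n, r n ≤ 1) {w : ℂ} {m : D.I}
    (hw : w ∈ D.disk m (r m)) : |D.t m| - 1 ≤ ‖w‖ := by
  have h1 : ‖w - D.t m‖ < r m := mem_ball_iff_norm.1 hw
  have h2 := norm_sub_norm_le (D.t m : ℂ) w
  rw [Complex.norm_real, Real.norm_eq_abs, norm_sub_rev] at h2
  linarith [hr1 m]

/-- If one of the zeros is `tₘ`, its coefficient vanishes and the other zero is separated; if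
neither is in `T`, they form a pair. -/
theorem sepZero_or_nearPair_of_mem_zeroSet (hr0 : ∀ n, 0 < r n) (hr1 : ∀ n, r n ≤ 1)
    (hsep : ∀ n k, n ≠ k → 4 * r n ≤ |D.t n - D.t k|) {a : lp (fun _ : D.I => ℂ) 2} {w w' : ℂ}
    {m : D.I} (hm : 1 ≤ |D.t m|) (hw : w ∈ D.disk m (r m)) (hw' : w' ∈ D.disk m (r m))
    (hz : w ∈ D.zeroSet (D.ct a)) (hz' : w' ∈ D.zeroSet (D.ct a)) (hne : w ≠ w') :
    SepZero r a w ∨ SepZero r a w' ∨ NearPair r a w w' m := by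
  rcases mem_zeroSet_iff.1 hz with ⟨hT, h⟩ | ⟨n, rfl, h⟩ <;>
    rcases mem_zeroSet_iff.1 hz' with ⟨hT', h'⟩ | ⟨k, rfl, h'⟩
  · refine Or.inr (Or.inr (nearPair_of_mem_disk hr0 hr1 hsep hm hw hw' hT hT' ⟨h, h', ?_⟩))
    rw [ct_mob (sq_zero_coe a) 0 1 h (van_of_notMem hT) (van_of_notMem hT') hne.symm, h', mul_zero]
  · rw [eq_of_t_mem_disk hr0 hsep hw'] at h'
    exact Or.inl (sepZero_of_mem_disk hr0 hsep hw h h')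
  · rw [eq_of_t_mem_disk hr0 hsep hw] at h
    exact Or.inr (Or.inl (sepZero_of_mem_disk hr0 hsep hw' h' h))
  · rw [eq_of_t_mem_disk hr0 hsep hw, eq_of_t_mem_disk hr0 hsep hw'] at hne
    exact absurd rfl hne

/-- A multiple zero in a disk but off `T` pairs with itself. At a point of `T` it is separated
outright, since the coefficient and the extended value both vanish. -/
theorem sepZero_or_nearPair_of_mem_multipleZeroSet (hr0 : ∀ n, 0 < r n) (hr1 : ∀ n, r n ≤ 1)
    (hsep : ∀ n k, n ≠ k → 4 * r n ≤ |D.t n - D.t k|) {a : lp (fun _ : D.I => ℂ) 2} {w : ℂ}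
    (hw : 2 ≤ ‖w‖) (hz : w ∈ D.multipleZeroSet (D.ct a)) :
    SepZero r a w ∨ ∃ m, NearPair r a w w m := by
  rcases hz with ⟨hT, h⟩ | ⟨n, rfl, h, h1⟩
  · have hp := pairZero_of_two_le_order (sq_zero_coe a) hT h
    by_cases hd : ∃ m, w ∈ D.disk m (r m)
    · obtain ⟨m, hm⟩ := hd
      refine Or.inr ⟨m, nearPair_of_mem_disk hr0 hr1 hsep ?_ hm hm hT hT hp⟩
      have h1 : ‖w - D.t m‖ < r m := mem_ball_iff_norm.1 hm
      have h2 := norm_sub_norm_le w (D.t m : ℂ)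
      rw [Complex.norm_real, Real.norm_eq_abs] at h2
      linarith [hr1 m]
    · push Not at hd
      exact Or.inl (sepZero_of_notMem_disks hd hp.1)
  · refine Or.inl (sepZero_of_mem_disk hr0 hsep (Metric.mem_ball_self (hr0 n)) ?_
      ((coeffEqZero_iff a n).1 h))
    refine apply_eq_zero_of_analyticOrderAt_ne_zero fun h0 => ?_
    rw [h0] at h1
    exact absurd h1 (by norm_num)

end

/-! ### Contradiction with localization, and unbounded test sets -/

/-- If zeros are localized off some unbounded set, then no function of the space has separated
zeros or pairs of zeros close to `T` of arbitrarily large modulus. -/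
theorem not_localized {N : ℕ} {δ : ℝ} (hδ : 0 < δ)
    {a : lp (fun _ : D.I => ℂ) 2} (ha : a ≠ 0)
    (h : ∀ R : ℝ, (∃ w, R ≤ ‖w‖ ∧ SepZero (fun n => δ / (1 + |D.t n|) ^ N) a w) ∨
      ∃ w w' m, R ≤ ‖w‖ ∧ R ≤ ‖w'‖ ∧ NearPair (fun n => δ / (1 + |D.t n|) ^ N) a w w' m)
    (hloc : ∃ S : Set ℂ, ¬ Bornology.IsBounded S ∧
        ∀ f ∈ D.space, f ≠ 0 → (D.zeroSet f ∩ S).Finite) : False := by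
  obtain ⟨S, hS, hfin⟩ := hloc
  obtain ⟨b, hb, hzero⟩ := exists_zeros_in hδ (fun n => le_rfl) (sq_zero_coe a) (coe_ne_zero ha) h
    (not_isBounded_iff.1 hS)
  refine infinite_of_exists_large (fun R => ?_) (hfin (D.ct b) ⟨b, rfl⟩ (ct_ne_zero hb))
  obtain ⟨s, hs, hR, h1, h2⟩ := hzero R
  refine ⟨s, ⟨mem_zeroSet_iff.2 ?_, hs⟩, hR⟩
  by_cases hT : s ∈ D.T
  · obtain ⟨n, hn⟩ := hT
    exact Or.inr ⟨n, hn.symm, h2 n hn⟩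
  · exact Or.inl ⟨hT, h1 hT⟩

/-- The points `i y` with `y ≥ 1`. -/
def imagRay : Set ℂ := {z | z.re = 0 ∧ 1 ≤ z.im}

theorem not_isBounded_imagRay : ¬ Bornology.IsBounded imagRay := by
  refine not_isBounded_iff.2 fun R => ⟨⟨0, max R 1⟩, ⟨rfl, le_max_right _ _⟩, ?_⟩
  refine (le_max_left R 1).trans ((le_abs_self _).trans ?_)
  exact Complex.abs_im_le_norm ⟨0, max R 1⟩

theorem one_le_norm_sub_of_mem_imagRay {z : ℂ} (hz : z ∈ imagRay) (n : D.I) :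
    1 ≤ ‖z - D.t n‖ := by
  have h := Complex.abs_im_le_norm (z - D.t n)
  rw [Complex.sub_im, Complex.ofReal_im, sub_zero] at h
  exact hz.2.trans ((le_abs_self _).trans h)

theorem notMem_T_of_mem_imagRay {z : ℂ} (hz : z ∈ imagRay) : z ∉ D.T := by
  rintro ⟨n, rfl⟩
  have := one_le_norm_sub_of_mem_imagRay hz n
  rw [sub_self, norm_zero] at this
  linarith

/-- The complement of a family of pairwise disjoint disks centered at the points of `T` is
unbounded. -/
theorem not_isBounded_compl_disks {r : D.I → ℝ} (hr : ∀ n, 0 < r n)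
    (hdisj : Pairwise fun n k : D.I => Disjoint (D.disk n (r n)) (D.disk k (r k))) :
    ¬ Bornology.IsBounded (⋃ n, D.disk n (r n))ᶜ := by
  -- A boundary point of one disk lies in no other: an open set disjoint from a ball is disjoint
  -- from its closure.
  have key : ∀ n (p : ℂ), ‖p - D.t n‖ = r n → p ∈ (⋃ n, D.disk n (r n))ᶜ := by
    intro n p hp hmem
    obtain ⟨k, hk⟩ := Set.mem_iUnion.1 hmem
    by_cases hkn : k = n
    · subst hkn
      have := mem_ball_iff_norm.1 hk
      linarith
    · have h1 := (hdisj (Ne.symm hkn)).closure_left Metric.isOpen_ball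
      rw [disk, closure_ball _ (hr n).ne'] at h1
      exact Set.disjoint_left.1 h1 (mem_closedBall_iff_norm.2 hp.le) hk
  refine not_isBounded_iff.2 fun R => ?_
  obtain ⟨n, hn⟩ := D.exists_large_t R
  have h0 := hr n
  rcases le_total 0 (D.t n) with h | h
  · refine ⟨((D.t n + r n : ℝ) : ℂ), key n _ ?_, ?_⟩
    · rw [Complex.ofReal_add, add_sub_cancel_left, Complex.norm_real, Real.norm_of_nonneg h0.le]
    · rw [Complex.norm_real, Real.norm_of_nonneg (by linarith)]
      rw [abs_of_nonneg h] at hn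
      linarith
  · refine ⟨((D.t n - r n : ℝ) : ℂ), key n _ ?_, ?_⟩
    · rw [Complex.ofReal_sub, sub_sub_cancel_left, norm_neg, Complex.norm_real,
        Real.norm_of_nonneg h0.le]
    · rw [Complex.norm_real, Real.norm_of_nonpos (by linarith)]
      rw [abs_of_nonpos h] at hn
      linarith

end CauchyData

/-! ### The equivalences, each through (i) -/

theorem mainTheorem2 (D : CauchyData) (hT : D.PowerSeparated) :
    List.TFAE [
      -- (i)
      ∃ S : Set ℂ, ¬ Bornology.IsBounded S ∧
        ∀ f ∈ D.space, f ≠ 0 → (D.zeroSet f ∩ S).Finite,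
      -- (ii)
      ∀ f ∈ D.space, f ≠ 0 → (D.zeroSet f \ ⋃ n : D.I, D.disk n 1).Finite,
      -- (iii)
      ∃ r : D.I → ℝ, (∀ n, 0 < r n) ∧
        (Pairwise fun n k : D.I => Disjoint (D.disk n (r n)) (D.disk k (r k))) ∧
        ∀ f ∈ D.space, f ≠ 0 →
          (D.zeroSet f \ ⋃ n : D.I, D.disk n (r n)).Finite ∧
          {n : D.I | ¬ (D.zeroSet f ∩ D.disk n (r n)).Subsingleton}.Finite,
      -- (iv)
      ¬ ∃ f ∈ D.space, f ≠ 0 ∧ (D.multipleZeroSet f).Infinite] := by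
  obtain ⟨δ, hδ, hδ1, N, hsep⟩ := hT.exists_radii
  set r : D.I → ℝ := fun n => δ / (1 + |D.t n|) ^ N
  have hr0 : ∀ n, 0 < r n := fun n => by positivity
  have hr1 : ∀ n, r n ≤ 1 := fun n => by
    refine (div_le_self hδ.le (one_le_pow₀ (by linarith [abs_nonneg (D.t n)]))).trans ?_
    linarith
  have hdisj : Pairwise fun n k : D.I => Disjoint (D.disk n (r n)) (D.disk k (r k)) := by
    intro n k hnk
    refine Metric.ball_disjoint_ball ?_
    have h1 := hsep n k hnk
    have h2 := hsep k n hnk.symm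
    rw [abs_sub_comm] at h2
    rw [dist_eq_norm, CauchyData.norm_t_sub_t]
    linarith [hr0 n, hr0 k]
  -- Serves radii 1 for (ii) and radii `r` for (iii).
  have hout : ∀ (a : lp (fun _ : D.I => ℂ) 2) (ρ : D.I → ℝ), (∀ n, r n ≤ ρ n) → a ≠ 0 →
      (D.zeroSet (D.ct a) \ ⋃ n : D.I, D.disk n (ρ n)).Infinite →
      ∀ R : ℝ, ∃ w, R ≤ ‖w‖ ∧ CauchyData.SepZero r a w := by
    intro a ρ hρ ha hinf R
    obtain ⟨w, ⟨hw, hwd⟩, hR⟩ := CauchyData.exists_large_of_infinite ha hinf Set.sdiff_subset R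
    have hwd' : ∀ n, w ∉ D.disk n (ρ n) := fun n hn => hwd (Set.mem_iUnion.2 ⟨n, hn⟩)
    refine ⟨w, hR, CauchyData.sepZero_of_notMem_disks
      (fun n hn => hwd' n (Metric.ball_subset_ball (hρ n) hn)) ?_⟩
    rcases CauchyData.mem_zeroSet_iff.1 hw with ⟨-, h⟩ | ⟨n, rfl, -⟩
    · exact h
    · exact absurd (Metric.mem_ball_self ((hr0 n).trans_le (hρ n))) (hwd' n)
  tfae_have 1 → 2 := by
    rintro hloc _ ⟨a, rfl⟩ hf
    have ha := CauchyData.ne_zero_of_ct_ne_zero hf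
    by_contra hinf
    exact CauchyData.not_localized (N := N) hδ ha
      (fun R => Or.inl (hout a (fun _ => 1) hr1 ha hinf R)) hloc
  tfae_have 2 → 1 := by
    intro h
    refine ⟨CauchyData.imagRay, CauchyData.not_isBounded_imagRay, fun f hf hf0 => ?_⟩
    refine (h f hf hf0).subset ?_
    rintro z ⟨hz, hzi⟩
    refine ⟨hz, fun hmem => ?_⟩
    obtain ⟨n, hn⟩ := Set.mem_iUnion.1 hmem
    have h1 := CauchyData.one_le_norm_sub_of_mem_imagRay hzi n
    have h2 : ‖z - D.t n‖ < 1 := mem_ball_iff_norm.1 hn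
    linarith
  tfae_have 1 → 3 := by
    intro hloc
    refine ⟨r, hr0, hdisj, ?_⟩
    rintro _ ⟨a, rfl⟩ hf
    have ha := CauchyData.ne_zero_of_ct_ne_zero hf
    refine ⟨?_, ?_⟩
    · by_contra hinf
      exact CauchyData.not_localized (N := N) hδ ha
        (fun R => Or.inl (hout a r (fun _ => le_rfl) ha hinf R)) hloc
    · by_contra hinf
      refine CauchyData.not_localized (N := N) hδ ha (fun R => ?_) hloc
      obtain ⟨m, hm, hmR⟩ : ∃ m ∈ {n : D.I | ¬ (D.zeroSet (D.cauchyTransform a) ∩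
          D.disk n (r n)).Subsingleton}, max R 0 + 1 < |D.t m| := by
        by_contra! hcon
        exact hinf ((CauchyData.finite_t_le (max R 0 + 1)).subset
          fun m hm => hcon m (Set.not_subsingleton_iff.1 hm))
      obtain ⟨w, ⟨hz, hw⟩, w', ⟨hz', hw'⟩, hne⟩ := Set.not_subsingleton_iff.1 hm
      have h1 := CauchyData.le_norm_of_mem_disk hr1 hw
      have h2 := CauchyData.le_norm_of_mem_disk hr1 hw'
      have h3 := le_max_left R 0
      have h4 := le_max_right R 0
      rcases CauchyData.sepZero_or_nearPair_of_mem_zeroSet hr0 hr1 hsep (by linarith) hw hw' hz hz'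
        hne with h | h | h
      · exact Or.inl ⟨w, by linarith, h⟩
      · exact Or.inl ⟨w', by linarith, h⟩
      · exact Or.inr ⟨w, w', m, by linarith, by linarith, h⟩
  tfae_have 3 → 1 := by
    rintro ⟨ρ, hρ, hd, h⟩
    exact ⟨_, CauchyData.not_isBounded_compl_disks hρ hd, fun f hf hf0 => (h f hf hf0).1⟩
  tfae_have 1 → 4 := by
    rintro hloc ⟨_, ⟨a, rfl⟩, hf, hinf⟩
    have ha := CauchyData.ne_zero_of_ct_ne_zero hf
    refine CauchyData.not_localized (N := N) hδ ha (fun R => ?_) hloc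
    obtain ⟨w, hw, hR⟩ := CauchyData.exists_large_of_infinite ha hinf
      (CauchyData.multipleZeroSet_subset _) (max R 2)
    have h1 := (le_max_left R 2).trans hR
    rcases CauchyData.sepZero_or_nearPair_of_mem_multipleZeroSet hr0 hr1 hsep
      ((le_max_right R 2).trans hR) hw with h | ⟨m, h⟩
    · exact Or.inl ⟨w, h1, h⟩
    · exact Or.inr ⟨w, w, m, h1, h1, h⟩
  tfae_have 4 → 1 := by
    intro h4
    refine ⟨CauchyData.imagRay, CauchyData.not_isBounded_imagRay, ?_⟩
    rintro _ ⟨a, rfl⟩ hf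
    have ha := CauchyData.ne_zero_of_ct_ne_zero hf
    by_contra hinf
    -- Points of the ray are at distance at least `1 ≥ r n` from every `tₙ`, so zeros there are
    -- separated whatever the coefficients.
    have hmany : CauchyData.ManySep D.Tᶜ r a := by
      intro R
      obtain ⟨w, ⟨hw, hwi⟩, hR⟩ := CauchyData.exists_large_of_infinite ha hinf
        Set.inter_subset_left R
      have hwT : w ∉ D.T := CauchyData.notMem_T_of_mem_imagRay hwi
      refine ⟨w, hwT, hR, ?_, fun n hn => ?_⟩
      · rcases CauchyData.mem_zeroSet_iff.1 hw with ⟨-, h⟩ | ⟨n, rfl, -⟩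
        · exact h
        · exact absurd ⟨n, rfl⟩ hwT
      · linarith [CauchyData.one_le_norm_sub_of_mem_imagRay hwi n, hr1 n]
    obtain ⟨b, hb, hdouble⟩ := hmany.exists_double_zeros hδ (fun n => le_rfl)
      (CauchyData.sq_zero_coe a) (CauchyData.coe_ne_zero ha)
    refine h4 ⟨D.ct b, ⟨b, rfl⟩, CauchyData.ct_ne_zero hb,
      CauchyData.infinite_of_exists_large fun R => ?_⟩
    obtain ⟨s, hs, hR, -, hp⟩ := hdouble R
    exact ⟨s, Or.inl ⟨hs, hp.two_le_order (CauchyData.sq_zero_coe b) hs⟩, hR⟩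
  tfae_finish
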